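/- Let $\mathbb{Q}$ be the real quaternions. For a quaternion matrix $\mathbf{G}=G_w+G_x\mathbf{i}+G_y\mathbf{j}+G_z\mathbf{k}$ write $\mathbf{G}_r=[G_w^T,G_x^T,G_y^T,G_z^T]^T$, and let $\|\mathbf G\|_F=\|\mathbf G_r\|_F$. The range $\mathcal{R}(\mathbf G)$ is the right span of the columns, and $\mathbf G^\dagger$ is the Moore--Penrose inverse. A real random variable $\xi$ is sub-Gaussian if $\mathbb{P}(|\xi|>t)\le \exp(1-ct^2)$ for all $t>0$ and some $c>0$; its sub-Gaussian norm is $\|\xi\|_{\psi_2}=\sup_{p\ge1}p^{-1/2}(\mathbb{E}|\xi|^p)^{1/p}$. There are absolute constants $c_1,c_2>0$ and, for every $K$, a constant $C_K>0$ depending only on $K$, such that the following holds. Let $r<s<l<\min\{m,n\}$ and let $\mathbf A\in\mathbb{Q}^{m\times n}$ be a fixed matrix with singular value decomposition $$\mathbf A=\mathbf U\Sigma\mathbf V^*,\qquad \Sigma=\begin{bmatrix}\Sigma_1&0\\0&\Sigma_2\end{bmatrix},\quad \Sigma_1\in\mathbb{R}^{r\times r},$$ where $\mathbf U,\mathbf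 V$ are unitary and $\Sigma\in\mathbb{R}^{m\times n}$ is diagonal with nonnegative, nonincreasing diagonal entries. Let $\boldsymbol\Omega\in\mathbb{Q}^{n\times s}$ and $\boldsymbol\Psi\in\mathbb{Q}^{l\times m}$ be independent random matrices such that the entries of $\boldsymbol\Omega_r$ are independent, the entries of $\boldsymbol\Psi_r$ are independent, and all these entries are centered sub-Gaussian real random variables with unit variance and the same sub-Gaussian norm $K$. Let $t>0$ satisfy $\sqrt l-C_K\sqrt s-t>0$ and $\sqrt s-C_K\sqrt r-t>0$. Then, with probability at least $$1-2\exp\left(-\frac{2c_2t^2}{K^4}\right)-\frac1{\min\{m-s,n\}}-\frac1{\min\{m,n\}-r},$$ for every $\mathbf H\in\mathbb{Q}^{m\times s}$ with $\mathcal{R}(\mathbf H)=\mathcal{R}(\mathbf A\boldsymbol\Omega)$ and $\mathbf X=(\boldsymbol\Psi\mathbf H)^\dagger\boldsymbol\Psi\mathbf A$, $$\|\mathbf{HX}-\mathbf A\|_F\le\left(1+\frac{K\sqrt l\sqrt{2(\log(\min\{m-s,n\})+\log(4l)+1)/c_1}}{\sqrt l-C_K\sqrt s-t}\right)\left(1+\frac{K\sqrt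 s\sqrt{2(\log(\min\{m,n\}-r)+\log(4s)+1)/c_1}}{\sqrt s-C_K\sqrt r-t}\right)\|\Sigma_2\|_F .$$ -/

import Mathlib

open MeasureTheory ProbabilityTheory
open scoped ENNReal Matrix Quaternion
open scoped Matrix.Norms.Frobenius

noncomputable section

namespace QuaternionSketch

/-- A real random variable `ξ` is sub-Gaussian if `ℙ(|ξ| > t) ≤ exp (1 - c t²)` for all `t > 0`
and some constant `c > 0`. -/
def IsSubGaussian {S : Type*} [MeasurableSpace S] (μ : Measure S) (ξ : S → ℝ) : Prop :=
  ∃ c : ℝ, 0 < c ∧ ∀ t : ℝ, 0 < t → μ.real {ω | t < |ξ ω|} ≤ Real.exp (1 - c * t ^ 2)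

/-- The sub-Gaussian norm `sup_{p ≥ 1} p^{-1/2} (𝔼 |ξ|^p)^{1/p}`, with values in `[0, ∞]`. -/
def psi2Norm {S : Type*} [MeasurableSpace S] (μ : Measure S) (ξ : S → ℝ) : ℝ≥0∞ :=
  ⨆ (p : ℝ) (_ : 1 ≤ p), ENNReal.ofReal (p ^ (-(1 / 2 : ℝ))) * eLpNorm ξ (ENNReal.ofReal p) μ

/-- The compact real representation `Q_r = [Q_w; Q_x; Q_y; Q_z]` of a quaternion matrix
`Q = Q_w + Q_x i + Q_y j + Q_z k`: four blocks of rows, indexed by `Fin 4`. -/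
def compactReal {m n : ℕ} (Q : Matrix (Fin m) (Fin n) ℍ[ℝ]) :
    Matrix (Fin 4 × Fin m) (Fin n) ℝ :=
  Matrix.of fun p j =>
    ![(Q p.2 j).re, (Q p.2 j).imI, (Q p.2 j).imJ, (Q p.2 j).imK] p.1

/-- A centered, unit variance quaternion sub-Gaussian random matrix: the entries of its compact
real representation are independent centered sub-Gaussian random variables of variance one. -/
structure IsSubGaussianMatrix {S : Type*} [MeasurableSpace S] (μ : Measure S) {m n : ℕ}
    (G : S → Matrix (Fin m) (Fin n) ℍ[ℝ]) : Prop where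
  measurable : ∀ p j, Measurable fun ω => compactReal (G ω) p j
  indep : iIndepFun (fun (q : (Fin 4 × Fin m) × Fin n) ω => compactReal (G ω) q.1 q.2) μ
  subGaussian : ∀ p j, IsSubGaussian μ fun ω => compactReal (G ω) p j
  centered : ∀ p j, ∫ ω, compactReal (G ω) p j ∂μ = 0
  unit_variance : ∀ p j, variance (fun ω => compactReal (G ω) p j) μ = 1

/-- `P` is the Moore-Penrose inverse of the quaternion matrix `M`. -/
structure IsMoorePenrose {m n : ℕ} (M : Matrix (Fin m) (Fin n) ℍ[ℝ])
    (P : Matrix (Fin n) (Fin m) ℍ[ℝ]) : Prop where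
  mul_mul_left : M * P * M = M
  mul_mul_right : P * M * P = P
  left_hermitian : (M * P)ᴴ = M * P
  right_hermitian : (P * M)ᴴ = P * M

/-- The range of a quaternion matrix: the right span `{∑ⱼ vⱼ kⱼ}` of its columns `vⱼ`. -/
def rightRange {m n : ℕ} (M : Matrix (Fin m) (Fin n) ℍ[ℝ]) : Set (Fin m → ℍ[ℝ]) :=
  Set.range fun k : Fin n → ℍ[ℝ] => M *ᵥ k

/-- `(H, X)` is an output of the QB stage of the one-pass algorithm for the data matrix `A` and
the test matrices `Ω`, `Ψ`: with the sketches `Y = A Ω` and `W = Ψ A`, the matrix `H` is produced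
by a range-preserving rangefinder from `Y`, and `X = (Ψ H)† W`. -/
structure IsQBOutput {m n s l : ℕ} (A : Matrix (Fin m) (Fin n) ℍ[ℝ])
    (Ω : Matrix (Fin n) (Fin s) ℍ[ℝ]) (Ψ : Matrix (Fin l) (Fin m) ℍ[ℝ])
    (H : Matrix (Fin m) (Fin s) ℍ[ℝ]) (X : Matrix (Fin s) (Fin n) ℍ[ℝ]) : Prop where
  range_eq : rightRange H = rightRange (A * Ω)
  solve : ∃ P : Matrix (Fin s) (Fin l) ℍ[ℝ], IsMoorePenrose (Ψ * H) P ∧ X = P * (Ψ * A)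

/-- The rectangular diagonal real matrix with diagonal `σ`. -/
def rectDiagonal {m n : ℕ} (σ : Fin (min m n) → ℝ) : Matrix (Fin m) (Fin n) ℝ :=
  Matrix.of fun i j =>
    if h : (i : ℕ) = (j : ℕ) then σ ⟨i, lt_min i.isLt (h ▸ j.isLt)⟩ else 0

/-- `A = U Σ V*` is a singular value decomposition of the quaternion matrix `A`: `U`, `V` are
unitary and `Σ` is the rectangular diagonal real matrix with nonincreasing nonnegative
diagonal `σ`. -/
structure IsQSVD {m n : ℕ} (A : Matrix (Fin m) (Fin n) ℍ[ℝ]) (U : Matrix (Fin m) (Fin m) ℍ[ℝ])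
    (σ : Fin (min m n) → ℝ) (V : Matrix (Fin n) (Fin n) ℍ[ℝ]) : Prop where
  left_unitary : U ∈ unitary (Matrix (Fin m) (Fin m) ℍ[ℝ])
  right_unitary : V ∈ unitary (Matrix (Fin n) (Fin n) ℍ[ℝ])
  nonneg : ∀ i, 0 ≤ σ i
  antitone : Antitone σ
  eq_mul : A = U * (rectDiagonal σ).map (fun x : ℝ => (x : ℍ[ℝ])) * Vᴴ

/-- The trailing block `Σ₂` of `Σ = [Σ₁ 0; 0 Σ₂]`, where `Σ₁` is the leading `r × r` block. -/
def sigmaTwo {m n : ℕ} (r : ℕ) (σ : Fin (min m n) → ℝ) :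
    Matrix {i : Fin m // r ≤ (i : ℕ)} {j : Fin n // r ≤ (j : ℕ)} ℝ :=
  (rectDiagonal σ).submatrix Subtype.val Subtype.val

end QuaternionSketch

end

namespace QuaternionSketch

/-! Put `Y = A Ω` and let `B = A - Y Z` be a least squares residual, so that `Yᴴ B = 0`. Since `H`
and `Y` have the same range, `H X - Y Z = Y Z₃` for some `Z₃`, and `Ψ Y Z₃ = Q Ψ B` with `Q = Ψ H (Ψ
H)†` an orthogonal projection. If `Ψ` shrinks no vector of the range of `Y` by more than the factor
`k` and satisfies `‖Ψ B‖ ≤ b ‖B‖`, then `‖H X - A‖ ≤ (1 + b / k) ‖B‖`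
(`norm_mul_sub_le_of_isQBOutput`). The residual `B` is itself minimal, so it can be compared with
the choice `Z' = T V₁ᴴ`, where `T` is a right inverse of `V₁ᴴ Ω`. This choice reproduces the leading
part of `A` exactly and leaves `A₂ - A₂ Ω T V₁ᴴ`, which gives the second factor
(`norm_sub_le_of_isQSVD`). None of these conditions mentions `H` or `X`, so one event serves all
outputs.

Two probabilistic estimates remain, each used for `Ψ` and for `Ωᴴ`.

Lower bound `k`: already the real parts of the coordinates of `G x` suffice. They are independent
sub-Gaussian linear forms, one for each row of `G`, so a Bernstein inequality for their squares
holds at a fixed `x`. A `1 / 4`-net makes it uniform over a range of real dimension at most `4 n`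
(`measureReal_exists_sum_sq_lt_le`); the constant `C_K` pays for the size of the net.

Upper bound `b`: `‖G B‖²` is a weighted sum of squares of sub-Gaussian variables, which need not be
independent of each other. Jensen and Markov give an exponential tail
(`measureReal_sum_weighted_sq_ge_le`), and the logarithms in the statement turn it into `1 / N`.

The matrices `Y` and `B` depend on `Ω` only. By independence, Fubini lets `Ω` be frozen while `Ψ` is
estimated. -/

theorem exp_le_one_add_add_sq_mul_exp_abs (x : ℝ) :
    Real.exp x ≤ 1 + x + x ^ 2 * Real.exp |x| := by
  have h := Complex.norm_exp_sub_sum_le_norm_mul_exp (x : ℂ) 2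
  have h2 : Complex.exp x - ∑ m ∈ Finset.range 2, (x : ℂ) ^ m / (m.factorial : ℂ)
      = ((Real.exp x - (1 + x) : ℝ) : ℂ) := by
    simp [Finset.sum_range_succ]
  rw [h2, Complex.norm_real, Complex.norm_real, Real.norm_eq_abs, Real.norm_eq_abs, sq_abs] at h
  linarith [le_abs_self (Real.exp x - (1 + x))]

/-- The exponential square integrability condition `𝔼 exp (ν X²) ≤ 2`. -/
structure ExpSqBound {S : Type*} [MeasurableSpace S] (X : S → ℝ) (ν : ℝ) (μ : Measure S) :
    Prop where
  aemeasurable : AEMeasurable X μ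
  integrable : Integrable (fun ω => Real.exp (ν * X ω ^ 2)) μ
  integral_le : ∫ ω, Real.exp (ν * X ω ^ 2) ∂μ ≤ 2

/-! ### Scalar sub-Gaussian variables: square exponential moments, moment generating functions,
Bernstein's inequality. -/

section Scalar

variable {S : Type*} [MeasurableSpace S] {μ : Measure S} {X : S → ℝ}

theorem ExpSqBound.of_lintegral_le {ν : ℝ} (hX : AEMeasurable X μ)
    (h : ∫⁻ ω, ENNReal.ofReal (Real.exp (ν * X ω ^ 2)) ∂μ ≤ 2) : ExpSqBound X ν μ := by
  have hm : AEStronglyMeasurable (fun ω => Real.exp (ν * X ω ^ 2)) μ :=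
    (by fun_prop : AEMeasurable (fun ω => Real.exp (ν * X ω ^ 2)) μ).aestronglyMeasurable
  refine ⟨hX, ⟨hm, ?_⟩, ?_⟩
  · rw [hasFiniteIntegral_iff_ofReal (Filter.Eventually.of_forall fun ω => (Real.exp_pos _).le)]
    exact h.trans_lt (by simp)
  · rw [integral_eq_lintegral_of_nonneg_ae (Filter.Eventually.of_forall fun ω => (Real.exp_pos _).le)
      hm]
    exact ENNReal.toReal_le_of_le_ofReal (by norm_num) (by simpa using h)

theorem lintegral_pow_le_of_psi2Norm_le {K : ℝ} (hK : 0 < K)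
    (h : psi2Norm μ X ≤ ENNReal.ofReal K) {k : ℕ} (hk : k ≠ 0) :
    ∫⁻ ω, ENNReal.ofReal (X ω ^ (2 * k)) ∂μ ≤ ENNReal.ofReal ((2 * k * K ^ 2) ^ k) := by
  have hk1 : (1 : ℝ) ≤ k := by exact_mod_cast Nat.one_le_iff_ne_zero.2 hk
  set p : ℝ := 2 * k with hp
  have hp1 : 1 ≤ p := by linarith
  have hp0 : 0 < p := by linarith
  have h1 : ENNReal.ofReal (p ^ (-(1 / 2 : ℝ))) * eLpNorm X (ENNReal.ofReal p) μ
      ≤ ENNReal.ofReal K :=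
    (le_iSup₂ (f := fun (p : ℝ) (_ : 1 ≤ p) =>
      ENNReal.ofReal (p ^ (-(1 / 2 : ℝ))) * eLpNorm X (ENNReal.ofReal p) μ) p hp1).trans h
  have h2 : eLpNorm X (ENNReal.ofReal p) μ ≤ ENNReal.ofReal (K * p ^ (1 / 2 : ℝ)) := by
    have h3 : ENNReal.ofReal (p ^ (1 / 2 : ℝ)) * (ENNReal.ofReal (p ^ (-(1 / 2 : ℝ))) *
        eLpNorm X (ENNReal.ofReal p) μ) ≤ ENNReal.ofReal (p ^ (1 / 2 : ℝ)) * ENNReal.ofReal K := by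
      gcongr
    rw [← mul_assoc, ← ENNReal.ofReal_mul (by positivity), ← Real.rpow_add hp0] at h3
    rw [mul_comm K, ENNReal.ofReal_mul (by positivity : (0 : ℝ) ≤ p ^ (1 / 2 : ℝ))]
    rwa [add_neg_cancel, Real.rpow_zero, ENNReal.ofReal_one, one_mul] at h3
  rw [eLpNorm_eq_lintegral_rpow_enorm_toReal (by simpa using hp0) (by simp),
    ENNReal.toReal_ofReal hp0.le] at h2
  have h4 := ENNReal.rpow_le_rpow h2 hp0.le
  rw [← ENNReal.rpow_mul, one_div_mul_cancel hp0.ne', ENNReal.rpow_one,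
    ENNReal.ofReal_rpow_of_nonneg (by positivity) hp0.le] at h4
  refine le_trans (lintegral_mono fun ω => ?_) (h4.trans (ENNReal.ofReal_le_ofReal ?_))
  · rw [Real.enorm_eq_ofReal_abs, ENNReal.ofReal_rpow_of_nonneg (abs_nonneg _) hp0.le]
    refine ENNReal.ofReal_le_ofReal (le_of_eq ?_)
    have : p = ((2 * k : ℕ) : ℝ) := by simp [hp]
    rw [this, Real.rpow_natCast, pow_mul, pow_mul, sq_abs]
  · have : p = ((2 * k : ℕ) : ℝ) := by simp [hp]
    nth_rewrite 2 [this]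
    rw [Real.rpow_natCast, mul_pow, ← Real.sqrt_eq_rpow, pow_mul, pow_mul, Real.sq_sqrt hp0.le,
      ← mul_pow, mul_comm]

/-- Expand the exponential. The moment of order `2 k` is at most `(2 k K²) ^ k`, so with `ν = 1 /
(12 K²)` and `k ^ k / k! ≤ e ^ k ≤ 3 ^ k` the term of index `k` is at most `2⁻ᵏ`, and the series
sums to `2`. -/
theorem ExpSqBound.of_psi2Norm_le [IsProbabilityMeasure μ] {K : ℝ} (hK : 0 < K)
    (hX : AEMeasurable X μ) (h : psi2Norm μ X ≤ ENNReal.ofReal K) :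
    ExpSqBound X (1 / (12 * K ^ 2)) μ := by
  refine .of_lintegral_le hX ?_
  set ν : ℝ := 1 / (12 * K ^ 2) with hν
  have hν0 : 0 < ν := by positivity
  have hser : ∀ ω, ENNReal.ofReal (Real.exp (ν * X ω ^ 2))
      = ∑' k : ℕ, ENNReal.ofReal ((ν * X ω ^ 2) ^ k / k.factorial) := fun ω => by
    rw [← ENNReal.ofReal_tsum_of_nonneg (fun k => by positivity)
      (Real.summable_pow_div_factorial _), Real.exp_eq_exp_ℝ, NormedSpace.exp_eq_tsum_div]
  simp_rw [hser]
  rw [lintegral_tsum (fun k => by fun_prop)]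
  have hterm : ∀ k : ℕ, ∫⁻ ω, ENNReal.ofReal ((ν * X ω ^ 2) ^ k / k.factorial) ∂μ
      ≤ (2⁻¹ : ℝ≥0∞) ^ k := by
    intro k
    rcases eq_or_ne k 0 with rfl | hk
    · simp
    have e1 : ∀ ω, ENNReal.ofReal ((ν * X ω ^ 2) ^ k / k.factorial)
        = ENNReal.ofReal (ν ^ k / k.factorial) * ENNReal.ofReal (X ω ^ (2 * k)) := fun ω => by
      rw [← ENNReal.ofReal_mul (by positivity), pow_mul]
      congr 1
      ring
    simp_rw [e1]
    rw [lintegral_const_mul' _ _ (by simp)]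
    calc _ ≤ ENNReal.ofReal (ν ^ k / k.factorial) * ENNReal.ofReal ((2 * k * K ^ 2) ^ k) := by
          gcongr
          exact lintegral_pow_le_of_psi2Norm_le hK h hk
      _ = ENNReal.ofReal ((1 / 6) ^ k * ((k : ℝ) ^ k / k.factorial)) := by
          rw [← ENNReal.ofReal_mul (by positivity)]
          congr 1
          have : (2 * k * K ^ 2) ^ k * ν ^ k = (1 / 6) ^ k * (k : ℝ) ^ k := by
            rw [← mul_pow, ← mul_pow, hν]
            congr 1
            field_simp
            norm_num
          rw [div_mul_eq_mul_div, mul_comm, this, mul_div_assoc]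
      _ ≤ ENNReal.ofReal ((1 / 2) ^ k) := by
          refine ENNReal.ofReal_le_ofReal ?_
          have h3 : (k : ℝ) ^ k / k.factorial ≤ 3 ^ k := by
            refine (Real.pow_div_factorial_le_exp _ k.cast_nonneg k).trans ?_
            rw [← Real.exp_one_rpow, Real.rpow_natCast]
            gcongr
            linarith [Real.exp_one_lt_d9]
          calc (1 / 6 : ℝ) ^ k * ((k : ℝ) ^ k / k.factorial) ≤ (1 / 6) ^ k * 3 ^ k := by gcongr
            _ = (1 / 2) ^ k := by rw [← mul_pow]; norm_num
      _ = (2⁻¹ : ℝ≥0∞) ^ k := by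
          rw [ENNReal.ofReal_pow (by norm_num), one_div, ENNReal.ofReal_inv_of_pos (by norm_num)]
          simp
  refine (ENNReal.tsum_le_tsum hterm).trans ?_
  rw [ENNReal.tsum_geometric, ENNReal.one_sub_inv_two, inv_inv]

/-- In `exp x ≤ 1 + x + x² exp |x|` at `x = t X` the linear term has mean zero. Young's inequality
`|t X| ≤ ν X² / 2 + t² / (2 ν)` splits the remainder: one factor `exp (ν X² / 2)` absorbs the
square, the other the exponential. -/
theorem ExpSqBound.hasSubgaussianMGF [IsProbabilityMeasure μ] {ν : ℝ} {c : NNReal} (hν : 0 < ν)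
    (h : ExpSqBound X ν μ) (h0 : ∫ ω, X ω ∂μ = 0) (hc : 9 / ν ≤ c) : HasSubgaussianMGF X c μ := by
  have hXm := h.aemeasurable
  have hmaj : ∀ t ω, |t * X ω| ≤ ν * X ω ^ 2 / 2 + t ^ 2 / (2 * ν) := fun t ω => by
    have h1 : ν * X ω ^ 2 / 2 + t ^ 2 / (2 * ν) = (ν * X ω ^ 2 + ν * (t / ν) ^ 2) / 2 := by
      field_simp
    have h2 : |t * X ω| = ν * (|t / ν| * |X ω|) := by
      rw [← abs_mul, ← abs_of_pos hν, ← abs_mul, abs_of_pos hν]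
      congr 1
      field_simp
    rw [h1, h2, ← sq_abs (X ω), ← sq_abs (t / ν)]
    nlinarith [mul_nonneg hν.le (sq_nonneg (|t / ν| - |X ω|))]
  have hhalf : ∀ ω, Real.exp (ν * X ω ^ 2 / 2) * Real.exp (ν * X ω ^ 2 / 2)
      = Real.exp (ν * X ω ^ 2) := fun ω => by rw [← Real.exp_add]; ring_nf
  have hone : ∀ ω, 1 ≤ Real.exp (ν * X ω ^ 2 / 2) := fun ω => Real.one_le_exp (by positivity)
  have hint : ∀ t, Integrable (fun ω => Real.exp (t * X ω)) μ := fun t => by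
    refine Integrable.mono' (h.integrable.const_mul (Real.exp (t ^ 2 / (2 * ν))))
      (by fun_prop : AEMeasurable (fun ω => Real.exp (t * X ω)) μ).aestronglyMeasurable
      (Filter.Eventually.of_forall fun ω => ?_)
    rw [Real.norm_of_nonneg (Real.exp_pos _).le, ← hhalf ω]
    calc Real.exp (t * X ω) ≤ Real.exp (ν * X ω ^ 2 / 2 + t ^ 2 / (2 * ν)) :=
          Real.exp_le_exp.2 ((le_abs_self _).trans (hmaj t ω))
      _ = Real.exp (t ^ 2 / (2 * ν)) * Real.exp (ν * X ω ^ 2 / 2) := by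
          rw [← Real.exp_add, add_comm]
      _ ≤ _ := by
          gcongr
          nlinarith [hone ω]
  have hXint : Integrable X μ := by
    refine Integrable.mono' (h.integrable.const_mul (Real.exp (1 / (2 * ν))))
      hXm.aestronglyMeasurable (Filter.Eventually.of_forall fun ω => ?_)
    have h1 := hmaj 1 ω
    rw [one_mul, one_pow] at h1
    rw [Real.norm_eq_abs, ← Real.exp_add]
    refine le_trans ?_ (Real.add_one_le_exp _)
    nlinarith [sq_nonneg (X ω)]
  refine ⟨hint, fun t => ?_⟩
  set D : ℝ := 2 * t ^ 2 / ν * Real.exp (t ^ 2 / (2 * ν)) with hD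
  have hD0 : 0 ≤ D := by positivity
  have hpt : ∀ ω, Real.exp (t * X ω) ≤ 1 + t * X ω + D * Real.exp (ν * X ω ^ 2) := fun ω => by
    refine (exp_le_one_add_add_sq_mul_exp_abs _).trans (add_le_add le_rfl ?_)
    have h1 : (t * X ω) ^ 2 ≤ 2 * t ^ 2 / ν * Real.exp (ν * X ω ^ 2 / 2) := by
      have h2 : (t * X ω) ^ 2 = 2 * t ^ 2 / ν * (ν * X ω ^ 2 / 2) := by field_simp
      rw [h2]
      gcongr
      linarith [Real.add_one_le_exp (ν * X ω ^ 2 / 2)]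
    calc (t * X ω) ^ 2 * Real.exp |t * X ω|
        ≤ (2 * t ^ 2 / ν * Real.exp (ν * X ω ^ 2 / 2)) *
          Real.exp (ν * X ω ^ 2 / 2 + t ^ 2 / (2 * ν)) := by
          gcongr
          exact hmaj t ω
      _ = D * Real.exp (ν * X ω ^ 2) := by rw [Real.exp_add, ← hhalf ω, hD]; ring
  have hle : mgf X μ t ≤ 1 + D * 2 := by
    have hi : Integrable (fun ω => 1 + t * X ω) μ := (integrable_const _).add (hXint.const_mul t)
    calc mgf X μ t ≤ ∫ ω, (1 + t * X ω + D * Real.exp (ν * X ω ^ 2)) ∂μ :=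
          integral_mono (hint t) (hi.add (h.integrable.const_mul D)) hpt
      _ = 1 + D * ∫ ω, Real.exp (ν * X ω ^ 2) ∂μ := by
          rw [integral_add hi (h.integrable.const_mul D),
            integral_add (integrable_const _) (hXint.const_mul t), integral_const_mul,
            integral_const_mul, h0]
          simp
      _ ≤ _ := by
          gcongr
          exact h.integral_le
  refine hle.trans ?_
  have ha : 0 ≤ t ^ 2 / (2 * ν) := by positivity
  have hb : 1 + 4 * t ^ 2 / ν ≤ Real.exp (4 * t ^ 2 / ν) := by
    linarith [Real.add_one_le_exp (4 * t ^ 2 / ν)]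
  -- The exponents `4 t² / ν` and `t² / (2 ν)` add up to `(9 / ν) t² / 2`, which is the source of
  -- the constant `9`.
  calc 1 + D * 2 = 1 + 4 * t ^ 2 / ν * Real.exp (t ^ 2 / (2 * ν)) := by rw [hD]; ring
    _ ≤ (1 + 4 * t ^ 2 / ν) * Real.exp (t ^ 2 / (2 * ν)) := by
        nlinarith [Real.one_le_exp ha]
    _ ≤ Real.exp (4 * t ^ 2 / ν) * Real.exp (t ^ 2 / (2 * ν)) := by gcongr
    _ = Real.exp (9 / ν * t ^ 2 / 2) := by
        rw [← Real.exp_add]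
        congr 1
        field_simp
        ring
    _ ≤ _ := by gcongr

theorem lintegral_exp_sq_gaussianReal_le :
    ∫⁻ g, ENNReal.ofReal (Real.exp (g ^ 2 / 4)) ∂(gaussianReal 0 1) ≤ 2 := by
  rw [gaussianReal_of_var_ne_zero _ one_ne_zero,
    lintegral_withDensity_eq_lintegral_mul _ (measurable_gaussianPDF 0 1) (by fun_prop)]
  have h1 : ∀ g : ℝ, (gaussianPDF 0 1 * fun g => ENNReal.ofReal (Real.exp (g ^ 2 / 4))) g
      = ENNReal.ofReal ((√(2 * Real.pi))⁻¹ * Real.exp (-(1 / 4) * g ^ 2)) := fun g => by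
    rw [Pi.mul_apply, gaussianPDF, ← ENNReal.ofReal_mul (gaussianPDFReal_nonneg 0 1 g),
      gaussianPDFReal, mul_assoc, ← Real.exp_add]
    congr 2
    · simp
    · congr 1
      simp
      ring
  simp_rw [h1]
  rw [← ofReal_integral_eq_lintegral_ofReal
    ((integrable_exp_neg_mul_sq (by norm_num)).const_mul _)
    (Filter.Eventually.of_forall fun g => by positivity), integral_const_mul, integral_gaussian]
  rw [← Real.sqrt_inv, ← Real.sqrt_mul (by positivity)]
  have h2 : (2 * Real.pi)⁻¹ * (Real.pi / (1 / 4)) = 2 := by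
    field_simp
    norm_num
  rw [h2]
  have h3 : √(2 : ℝ) ≤ 2 := by
    rw [Real.sqrt_le_left (by norm_num)]
    norm_num
  exact (ENNReal.ofReal_le_ofReal h3).trans (by simp)

/-- Linearization by an auxiliary standard Gaussian `g`: `exp (X² / (4 c))` is the mean over `g` of
`exp (τ X g)` with `τ² = 1 / (2 c)`. After exchanging the integrals, the bound on the moment
generating function of `X` leaves the mean of `exp (g² / 4)`, which is `√2`. -/
theorem _root_.ProbabilityTheory.HasSubgaussianMGF.expSqBound [IsProbabilityMeasure μ] {c : NNReal}
    (hc : 0 < c) (h : HasSubgaussianMGF X c μ) : ExpSqBound X (1 / (4 * c)) μ := by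
  wlog hXm : Measurable X generalizing X
  · have h1 := this (h.congr h.aemeasurable.ae_eq_mk) h.aemeasurable.measurable_mk
    have h2 : (fun ω => Real.exp (1 / (4 * (c : ℝ)) * h.aemeasurable.mk X ω ^ 2)) =ᵐ[μ]
        fun ω => Real.exp (1 / (4 * (c : ℝ)) * X ω ^ 2) := by
      filter_upwards [h.aemeasurable.ae_eq_mk] with ω hω
      rw [hω]
    exact ⟨h.aemeasurable, h1.integrable.congr h2, (integral_congr_ae h2).symm.trans_le
      h1.integral_le⟩
  refine .of_lintegral_le hXm.aemeasurable ?_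
  have hc0 : (0 : ℝ) < c := hc
  set τ : ℝ := √(1 / (2 * c)) with hτ
  have hτ2 : τ ^ 2 = 1 / (2 * c) := Real.sq_sqrt (by positivity)
  have h1 : ∀ ω, ENNReal.ofReal (Real.exp (1 / (4 * (c : ℝ)) * X ω ^ 2))
      = ∫⁻ g, ENNReal.ofReal (Real.exp ((τ * X ω) * g)) ∂(gaussianReal 0 1) := fun ω => by
    rw [← ofReal_integral_eq_lintegral_ofReal (integrable_exp_mul_gaussianReal _)
      (Filter.Eventually.of_forall fun g => (Real.exp_pos _).le)]
    have := mgf_gaussianReal (p := gaussianReal 0 1) (X := id) (μ := 0) (v := 1) (by simp) (τ * X ω)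
    simp only [mgf, id] at this
    rw [this]
    congr 2
    simp only [NNReal.coe_one, mul_pow, hτ2]
    field_simp
    ring
  simp_rw [h1]
  rw [lintegral_lintegral_swap (by fun_prop)]
  refine le_trans (lintegral_mono fun g => ?_) lintegral_exp_sq_gaussianReal_le
  have h2 : ∀ ω, τ * X ω * g = (τ * g) * X ω := fun ω => by ring
  simp_rw [h2]
  rw [← ofReal_integral_eq_lintegral_ofReal (h.integrable_exp_mul _)
    (Filter.Eventually.of_forall fun g => (Real.exp_pos _).le)]
  refine ENNReal.ofReal_le_ofReal ((h.mgf_le _).trans (le_of_eq ?_))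
  rw [mul_pow, hτ2]
  congr 1
  field_simp
  ring

theorem ExpSqBound.integrable_sq {ν : ℝ} (hν : 0 < ν) (h : ExpSqBound X ν μ) :
    Integrable (fun ω => X ω ^ 2) μ := by
  have hXm := h.aemeasurable
  refine Integrable.mono' (h.integrable.const_mul (1 / ν))
    (by fun_prop : AEMeasurable (fun ω => X ω ^ 2) μ).aestronglyMeasurable
    (Filter.Eventually.of_forall fun ω => ?_)
  rw [Real.norm_of_nonneg (by positivity), one_div, inv_mul_eq_div, le_div_iff₀ hν]
  nlinarith [Real.add_one_le_exp (ν * X ω ^ 2)]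

/-- The same second order expansion, now for the centered variable `X² - 1`. With `y = ν (X² + 1) /
2`, both the square (through `y² / 2 ≤ exp y`) and the exponential cost a factor `exp y`, and `exp
(2 y) ≤ 3 exp (ν X²)` because `ν ≤ 1`. Thus `48 = 8 · 3 · 2`. -/
theorem ExpSqBound.mgf_sq_sub_one_le [IsProbabilityMeasure μ] {ν : ℝ} (hν : 0 < ν) (hν1 : ν ≤ 1)
    (h : ExpSqBound X ν μ) (h1 : ∫ ω, X ω ^ 2 ∂μ = 1) {t : ℝ} (ht : |t| ≤ ν / 2) :
    Integrable (fun ω => Real.exp (t * (X ω ^ 2 - 1))) μ ∧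
      mgf (fun ω => X ω ^ 2 - 1) μ t ≤ Real.exp (48 * t ^ 2 / ν ^ 2) := by
  have hXm := h.aemeasurable
  have hmaj : ∀ ω, |t * (X ω ^ 2 - 1)| ≤ ν * (X ω ^ 2 + 1) / 2 := fun ω => by
    rw [abs_mul]
    have : |X ω ^ 2 - 1| ≤ X ω ^ 2 + 1 := by
      rw [abs_le]; constructor <;> nlinarith [sq_nonneg (X ω)]
    calc _ ≤ ν / 2 * (X ω ^ 2 + 1) := by gcongr
      _ = _ := by ring
  have hexp : ∀ ω, Real.exp (ν * (X ω ^ 2 + 1)) ≤ 3 * Real.exp (ν * X ω ^ 2) := fun ω => by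
    rw [mul_add, mul_one, Real.exp_add, mul_comm]
    gcongr
    exact (Real.exp_le_exp.2 hν1).trans (by linarith [Real.exp_one_lt_d9])
  have hint : Integrable (fun ω => Real.exp (t * (X ω ^ 2 - 1))) μ := by
    refine Integrable.mono' (h.integrable.const_mul 3)
      (by fun_prop : AEMeasurable (fun ω => Real.exp (t * (X ω ^ 2 - 1))) μ).aestronglyMeasurable
      (Filter.Eventually.of_forall fun ω => ?_)
    rw [Real.norm_of_nonneg (Real.exp_pos _).le]
    refine (Real.exp_le_exp.2 ?_).trans (hexp ω)
    refine (le_abs_self _).trans ((hmaj ω).trans ?_)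
    nlinarith [mul_nonneg hν.le (sq_nonneg (X ω))]
  refine ⟨hint, ?_⟩
  have hsq := h.integrable_sq hν
  set D : ℝ := 8 * t ^ 2 / ν ^ 2 with hD
  have hpt : ∀ ω, Real.exp (t * (X ω ^ 2 - 1))
      ≤ 1 + t * (X ω ^ 2 - 1) + D * (3 * Real.exp (ν * X ω ^ 2)) := fun ω => by
    refine (exp_le_one_add_add_sq_mul_exp_abs _).trans (add_le_add le_rfl ?_)
    set y : ℝ := ν * (X ω ^ 2 + 1) / 2 with hy
    have hy0 : 0 ≤ y := by positivity
    have e1 : (t * (X ω ^ 2 - 1)) ^ 2 ≤ D * (y ^ 2 / 2) := by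
      have : D * (y ^ 2 / 2) = t ^ 2 * (X ω ^ 2 + 1) ^ 2 := by
        rw [hD, hy]; field_simp; ring
      rw [this, mul_pow]
      gcongr ?_ * ?_
      nlinarith [sq_nonneg (X ω)]
    have e2 : y ^ 2 / 2 ≤ Real.exp y := by
      simpa using Real.pow_div_factorial_le_exp y hy0 2
    calc (t * (X ω ^ 2 - 1)) ^ 2 * Real.exp |t * (X ω ^ 2 - 1)|
        ≤ (D * Real.exp y) * Real.exp y := by
          gcongr
          · exact e1.trans (by gcongr)
          · exact hmaj ω
      _ = D * Real.exp (ν * (X ω ^ 2 + 1)) := by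
          rw [mul_assoc, ← Real.exp_add, hy]
          ring_nf
      _ ≤ _ := by
          gcongr
          exact hexp ω
  have hi0 : Integrable (fun ω => t * (X ω ^ 2 - 1)) μ :=
    (hsq.sub (integrable_const 1)).const_mul t
  have hi : Integrable (fun ω => 1 + t * (X ω ^ 2 - 1)) μ := (integrable_const _).add hi0
  have hi2 := (h.integrable.const_mul 3).const_mul D
  calc mgf (fun ω => X ω ^ 2 - 1) μ t
      ≤ ∫ ω, (1 + t * (X ω ^ 2 - 1) + D * (3 * Real.exp (ν * X ω ^ 2))) ∂μ :=
        integral_mono hint (hi.add hi2) hpt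
    _ = 1 + D * (3 * ∫ ω, Real.exp (ν * X ω ^ 2) ∂μ) := by
        rw [integral_add hi hi2, integral_add (integrable_const _) hi0, integral_const_mul,
          integral_const_mul, integral_const_mul, integral_sub hsq (integrable_const 1), h1]
        simp
    _ ≤ 1 + D * (3 * 2) := by
        gcongr
        exact h.integral_le
    _ = 48 * t ^ 2 / ν ^ 2 + 1 := by rw [hD]; ring
    _ ≤ _ := Real.add_one_le_exp _

theorem measureReal_abs_sum_sq_sub_ge_le [IsProbabilityMeasure μ] {l : ℕ} {Y : Fin l → S → ℝ}
    {ν ε : ℝ} (hν : 0 < ν) (hν1 : ν ≤ 1) (hε : 0 ≤ ε) (hε1 : ε ≤ 1)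
    (hmeas : ∀ i, Measurable (Y i)) (hind : iIndepFun Y μ) (hY : ∀ i, ExpSqBound (Y i) ν μ)
    (h1 : ∀ i, ∫ ω, Y i ω ^ 2 ∂μ = 1) :
    μ.real {ω | ε * l ≤ |∑ i, Y i ω ^ 2 - l|} ≤ 2 * Real.exp (-(l * ν ^ 2 * ε ^ 2 / 192)) := by
  set Q : Fin l → S → ℝ := fun i ω => Y i ω ^ 2 - 1 with hQ
  have hQm : ∀ i, Measurable (Q i) := fun i => ((hmeas i).pow_const 2).sub_const 1
  have hQind : iIndepFun Q μ :=
    hind.comp (fun _ x => x ^ 2 - 1) fun _ => (measurable_id.pow_const 2).sub_const 1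
  -- The minimizer of the Chernoff exponent `-t ε l + 48 l t² / ν²`; it is admissible since `ν` and
  -- `ε` are at most `1`.
  set t : ℝ := ν ^ 2 * ε / 96 with ht
  have ht0 : 0 ≤ t := by positivity
  have htν : |t| ≤ ν / 2 := by
    rw [abs_of_nonneg ht0, ht]
    have : ν * (ν * ε) ≤ ν * 1 := by
      gcongr
      nlinarith
    nlinarith
  have htν' : |-t| ≤ ν / 2 := by rwa [abs_neg]
  have hmgf : ∀ s, |s| ≤ ν / 2 → mgf (∑ i, Q i) μ s ≤ Real.exp (l * (48 * s ^ 2 / ν ^ 2)) := by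
    intro s hs
    rw [hQind.mgf_sum hQm]
    calc ∏ i, mgf (Q i) μ s ≤ ∏ _i : Fin l, Real.exp (48 * s ^ 2 / ν ^ 2) :=
          Finset.prod_le_prod (fun i _ => mgf_nonneg)
            fun i _ => ((hY i).mgf_sq_sub_one_le hν hν1 (h1 i) hs).2
      _ = _ := by rw [Finset.prod_const, Finset.card_univ, Fintype.card_fin, ← Real.exp_nat_mul]
  have hintg : ∀ s, |s| ≤ ν / 2 → Integrable (fun ω => Real.exp (s * (∑ i, Q i) ω)) μ := by
    intro s hs
    exact hQind.integrable_exp_mul_sum hQm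
      fun i _ => ((hY i).mgf_sq_sub_one_le hν hν1 (h1 i) hs).1
  have hsum : ∀ ω, (∑ i, Q i) ω = ∑ i, Y i ω ^ 2 - l := fun ω => by
    simp [hQ, Finset.sum_apply]
  have hkey : -t * (ε * l) + l * (48 * t ^ 2 / ν ^ 2) = -(l * ν ^ 2 * ε ^ 2 / 192) := by
    rw [ht]; field_simp; ring
  have hub : μ.real {ω | ε * l ≤ (∑ i, Q i) ω} ≤ Real.exp (-(l * ν ^ 2 * ε ^ 2 / 192)) := by
    refine (measure_ge_le_exp_mul_mgf (ε * l) ht0 (hintg t htν)).trans ?_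
    rw [← hkey, Real.exp_add]
    gcongr
    exact hmgf t htν
  have hlb : μ.real {ω | (∑ i, Q i) ω ≤ -(ε * l)} ≤ Real.exp (-(l * ν ^ 2 * ε ^ 2 / 192)) := by
    refine (measure_le_le_exp_mul_mgf (-(ε * l)) (neg_nonpos.2 ht0) (hintg (-t) htν')).trans ?_
    rw [← hkey, Real.exp_add]
    have h2 := hmgf (-t) htν'
    rw [neg_sq] at h2
    have h3 : - -t * -(ε * l) = -t * (ε * l) := by ring
    rw [h3]
    gcongr
  calc μ.real {ω | ε * l ≤ |∑ i, Y i ω ^ 2 - l|}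
      ≤ μ.real ({ω | ε * l ≤ (∑ i, Q i) ω} ∪ {ω | (∑ i, Q i) ω ≤ -(ε * l)}) := by
        refine measureReal_mono fun ω hω => ?_
        rcases le_abs.1 (show ε * l ≤ |∑ i, Y i ω ^ 2 - l| from hω) with h | h
        · exact Or.inl (by simpa [hsum] using h)
        · exact Or.inr (show (∑ i, Q i) ω ≤ -(ε * l) by rw [hsum]; linarith)
    _ ≤ _ := (measureReal_union_le _ _).trans (by linarith)

end Scalar

/-! ### Nets in normed spaces and quadratic forms controlled on a net. -/

section Net

variable {E : Type*} [NormedAddCommGroup E]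

/-- A `1`-separated subset of the ball of radius `2` has at most `5 ^ d` points; one of largest
cardinality is a net, since an uncovered point could be added to it. -/
theorem exists_finset_card_le_forall_norm_le_two [NormedSpace ℝ E] [FiniteDimensional ℝ E] :
    ∃ N : Finset E, N.card ≤ 5 ^ Module.finrank ℝ E ∧
      ∀ x : E, ‖x‖ ≤ 2 → ∃ y ∈ N, ‖x - y‖ ≤ 1 := by
  classical
  set P : Finset E → Prop := fun s => (∀ c ∈ s, ‖c‖ ≤ 2) ∧
    ∀ c ∈ s, ∀ d ∈ s, c ≠ d → 1 ≤ ‖c - d‖ with hP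
  set A : Set ℕ := {k | ∃ s, P s ∧ s.card = k} with hA
  have hbd : ∀ k ∈ A, k ≤ 5 ^ Module.finrank ℝ E := by
    rintro k ⟨s, hs, rfl⟩
    exact Besicovitch.card_le_of_separated s hs.1 hs.2
  have hbdd : BddAbove A := ⟨_, hbd⟩
  obtain ⟨N, hN, hcard⟩ := Nat.sSup_mem (s := A) ⟨0, ∅, by simp [hP], rfl⟩ hbdd
  refine ⟨N, hbd _ ⟨N, hN, rfl⟩, fun x hx => ?_⟩
  by_contra! hcon
  have hxN : x ∉ N := fun h => by
    have := hcon x h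
    simp at this
    linarith
  have hPi : P (insert x N) := by
    refine ⟨fun c hc => ?_, fun c hc d hd hcd => ?_⟩
    · rcases Finset.mem_insert.1 hc with rfl | hc
      · exact hx
      · exact hN.1 c hc
    · rcases Finset.mem_insert.1 hc with rfl | hc' <;>
        rcases Finset.mem_insert.1 hd with rfl | hd'
      · exact absurd rfl hcd
      · exact (hcon d hd').le
      · rw [norm_sub_rev]
        exact (hcon c hc').le
      · exact hN.2 c hc' d hd' hcd
  have := le_csSup hbdd (show (insert x N).card ∈ A from ⟨_, hPi, rfl⟩)
  rw [Finset.card_insert_of_notMem hxN, ← hcard] at this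
  omega

/-- The unit ball of a normed space of dimension `d` has a `1 / 4`-net with `25 ^ d` elements. -/
theorem exists_finset_card_le_forall_norm_le_one [NormedSpace ℝ E] [FiniteDimensional ℝ E] :
    ∃ N : Finset E, N.card ≤ 25 ^ Module.finrank ℝ E ∧
      ∀ x : E, ‖x‖ ≤ 1 → ∃ y ∈ N, ‖x - y‖ ≤ 1 / 4 := by
  classical
  obtain ⟨N, hcard, hN⟩ := exists_finset_card_le_forall_norm_le_two (E := E)
  -- Two rounds of approximation: `y` approximates `2 x`, then `z` approximates the doubled error `2
  -- (2 x - y)`.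
  refine ⟨Finset.image₂ (fun y z => (1 / 2 : ℝ) • y + (1 / 4 : ℝ) • z) N N, ?_, fun x hx => ?_⟩
  · calc _ ≤ N.card * N.card := Finset.card_image₂_le _ _ _
      _ ≤ 5 ^ Module.finrank ℝ E * 5 ^ Module.finrank ℝ E := Nat.mul_le_mul hcard hcard
      _ = _ := by rw [← mul_pow]; norm_num
  · have two : ∀ v : E, ‖v‖ ≤ 1 → ‖(2 : ℝ) • v‖ ≤ 2 := fun v hv => by
      rw [norm_smul]
      norm_num
      exact hv
    obtain ⟨y, hy, hxy⟩ := hN _ (two x hx)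
    obtain ⟨z, hz, hxz⟩ := hN _ (two _ hxy)
    refine ⟨_, Finset.mem_image₂_of_mem hy hz, ?_⟩
    have : x - ((1 / 2 : ℝ) • y + (1 / 4 : ℝ) • z)
        = (1 / 4 : ℝ) • ((2 : ℝ) • ((2 : ℝ) • x - y) - z) := by
      module
    rw [this, norm_smul]
    norm_num
    linarith

/-- Let `M` be the maximum of `|B x x|` on the unit ball, attained at `x₀`, and let `y` be a net
point near `x₀`. Then `B x₀ x₀ = B y y + B (x₀ - y) (x₀ + y)`, and the last term is at most `(9 /
16) M`, so it can be absorbed. Since `‖y‖ ≤ 5 / 4`, this leaves `M ≤ (25 / 7) δ`. -/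
theorem abs_bilin_self_le_of_net [InnerProductSpace ℝ E] [FiniteDimensional ℝ E]
    {B : E →ₗ[ℝ] E →ₗ[ℝ] ℝ} (hB : ∀ x y, B x y = B y x) {N : Finset E}
    (hN : ∀ x : E, ‖x‖ ≤ 1 → ∃ y ∈ N, ‖x - y‖ ≤ 1 / 4) {δ : ℝ} (hδ : 0 ≤ δ)
    (h : ∀ y ∈ N, |B y y| ≤ δ * ‖y‖ ^ 2) (x : E) : |B x x| ≤ 4 * δ * ‖x‖ ^ 2 := by
  have hcont : Continuous fun x => |B x x| := by
    have h1 : Continuous fun x => LinearMap.toContinuousLinearMap (B x) x :=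
      ((LinearMap.toContinuousLinearMap.toLinearMap ∘ₗ B).continuous_of_finiteDimensional).clm_apply
        continuous_id
    exact h1.abs
  obtain ⟨x₀, hx₀, hmax⟩ := (isCompact_closedBall (0 : E) 1).exists_isMaxOn
    ⟨0, by simp⟩ hcont.continuousOn
  set M := |B x₀ x₀| with hM
  have hM0 : 0 ≤ M := abs_nonneg _
  have hx₀' : ‖x₀‖ ≤ 1 := by simpa using hx₀
  have hall : ∀ x, |B x x| ≤ M * ‖x‖ ^ 2 := by
    intro x
    rcases eq_or_ne x 0 with rfl | hx
    · simp
    have hnx : 0 < ‖x‖ := norm_pos_iff.2 hx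
    have h1 : |B (‖x‖⁻¹ • x) (‖x‖⁻¹ • x)| ≤ M := by
      refine hmax ?_
      simp [norm_smul, hnx.ne']
    simp only [map_smul, LinearMap.smul_apply, smul_eq_mul, abs_mul, abs_inv, abs_norm] at h1
    rw [← mul_assoc, ← mul_inv, inv_mul_le_iff₀ (by positivity)] at h1
    linarith
  -- Polarization with weights `3` and `1 / 3`, which balance the norms `1 / 4` of `x₀ - y` and `9 /
  -- 4` of `x₀ + y`.
  have hpol : ∀ u v, |B u v| ≤ M * (9 * ‖u‖ ^ 2 + ‖v‖ ^ 2 / 9) / 2 := by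
    intro u v
    have h1 := hall ((3 : ℝ) • u + (1 / 3 : ℝ) • v)
    have h2 := hall ((3 : ℝ) • u - (1 / 3 : ℝ) • v)
    have h3 := parallelogram_law_with_norm ℝ ((3 : ℝ) • u) ((1 / 3 : ℝ) • v)
    have h4 : B u v = (B ((3 : ℝ) • u + (1 / 3 : ℝ) • v) ((3 : ℝ) • u + (1 / 3 : ℝ) • v)
        - B ((3 : ℝ) • u - (1 / 3 : ℝ) • v) ((3 : ℝ) • u - (1 / 3 : ℝ) • v)) / 4 := by
      simp only [map_add, map_sub, map_smul, LinearMap.add_apply, LinearMap.sub_apply,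
        LinearMap.smul_apply, smul_eq_mul, hB v u]
      ring
    have h5 : ‖(3 : ℝ) • u‖ = 3 * ‖u‖ := by rw [norm_smul]; norm_num
    have h6 : ‖(1 / 3 : ℝ) • v‖ = ‖v‖ / 3 := by rw [norm_smul]; norm_num; ring
    rw [h5, h6] at h3
    rw [h4, abs_div, abs_of_pos (by norm_num : (0 : ℝ) < 4), div_le_div_iff₀ (by norm_num)
      (by norm_num)]
    have h7 := abs_sub (B ((3 : ℝ) • u + (1 / 3 : ℝ) • v) ((3 : ℝ) • u + (1 / 3 : ℝ) • v))
      (B ((3 : ℝ) • u - (1 / 3 : ℝ) • v) ((3 : ℝ) • u - (1 / 3 : ℝ) • v))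
    have h8 : M * (‖(3 : ℝ) • u + (1 / 3 : ℝ) • v‖ ^ 2 + ‖(3 : ℝ) • u - (1 / 3 : ℝ) • v‖ ^ 2)
      = M * (2 * ((3 * ‖u‖) ^ 2 + (‖v‖ / 3) ^ 2)) := by rw [h3]
    nlinarith
  obtain ⟨y, hyN, hy⟩ := hN x₀ hx₀'
  have h1 : B x₀ x₀ = B y y + B (x₀ - y) (x₀ + y) := by
    simp only [map_add, map_sub, LinearMap.sub_apply, hB y x₀]
    ring
  have hyn : ‖y‖ ≤ 5 / 4 := by
    calc ‖y‖ = ‖x₀ - (x₀ - y)‖ := by rw [sub_sub_cancel]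
      _ ≤ ‖x₀‖ + ‖x₀ - y‖ := norm_sub_le _ _
      _ ≤ _ := by linarith
  have hvn : ‖x₀ + y‖ ≤ 9 / 4 := (norm_add_le _ _).trans (by linarith)
  have h2 := hpol (x₀ - y) (x₀ + y)
  have h3 : M * (9 * ‖x₀ - y‖ ^ 2 + ‖x₀ + y‖ ^ 2 / 9) / 2 ≤ M * (9 / 16) := by
    have e1 : ‖x₀ - y‖ ^ 2 ≤ (1 / 4) ^ 2 := by gcongr
    have e2 : ‖x₀ + y‖ ^ 2 ≤ (9 / 4) ^ 2 := by gcongr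
    have : M * (9 * ‖x₀ - y‖ ^ 2 + ‖x₀ + y‖ ^ 2 / 9) ≤ M * (9 / 8) := by
      gcongr
      linarith
    linarith
  have h4 : M ≤ δ * (5 / 4) ^ 2 + M * (9 / 16) := by
    calc M = |B y y + B (x₀ - y) (x₀ + y)| := by rw [hM, h1]
      _ ≤ |B y y| + |B (x₀ - y) (x₀ + y)| := abs_add_le _ _
      _ ≤ δ * ‖y‖ ^ 2 + M * (9 / 16) := add_le_add (h y hyN) (h2.trans h3)
      _ ≤ _ := by gcongr
  refine (hall x).trans ?_
  gcongr
  linarith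

end Net

/-! ### Independent rows and linear forms in independent sub-Gaussian variables. -/

section Independence

variable {S : Type*} [MeasurableSpace S] {μ : Measure S}

/-- Independence says that the joint law is a product measure; currying a product over pairs gives a
product of the laws of the rows. -/
theorem iIndepFun_rows {ι κ : Type*} [Fintype ι] [Fintype κ] {a : ι → κ → S → ℝ}
    (ha : ∀ i j, Measurable (a i j)) (h : iIndepFun (fun p : ι × κ => a p.1 p.2) μ) :
    iIndepFun (fun i ω j => a i j ω) μ := by
  have := h.isProbabilityMeasure
  have hp : ∀ i j, IsProbabilityMeasure (μ.map (a i j)) :=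
    fun i j => Measure.isProbabilityMeasure_map (ha i j).aemeasurable
  have hr : ∀ i, IsProbabilityMeasure (μ.map fun ω j => a i j ω) :=
    fun i => Measure.isProbabilityMeasure_map (Measurable.aemeasurable (by fun_prop))
  have hrow : ∀ i, iIndepFun (a i) μ := fun i =>
    h.precomp (g := fun j => (i, j)) fun _ _ hxy => (Prod.mk.inj hxy).2
  have hs : iIndepFun (fun (p : (_ : ι) × κ) ω => a p.1 p.2 ω) μ :=
    h.precomp (g := Equiv.sigmaEquivProd ι κ) (Equiv.sigmaEquivProd ι κ).injective
  rw [iIndepFun_iff_map_fun_eq_infinitePi_map (by fun_prop)] at hs ⊢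
  have hc : (fun ω i j => a i j ω)
      = (MeasurableEquiv.piCurry fun (_ : ι) (_ : κ) => ℝ) ∘
        (fun ω (p : (_ : ι) × κ) => a p.1 p.2 ω) := by
    ext; simp [Sigma.curry]
  rw [hc, ← Measure.map_map (by fun_prop) (by fun_prop), hs,
    Measure.infinitePi_map_piCurry fun i j => μ.map (a i j)]
  congr 1
  funext i
  exact ((iIndepFun_iff_map_fun_eq_infinitePi_map (by fun_prop)).1 (hrow i)).symm

/-- A family of independent centered random variables of variance one whose moment generating
functions are bounded by that of a Gaussian of variance `c`. -/
structure IsIndepSubGaussian {ι : Type*} (a : ι → S → ℝ) (c : NNReal) (μ : Measure S) : Prop where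
  measurable : ∀ i, Measurable (a i)
  indep : iIndepFun a μ
  subgaussian : ∀ i, HasSubgaussianMGF (a i) c μ
  centered : ∀ i, ∫ ω, a i ω ∂μ = 0
  variance_eq : ∀ i, variance (a i) μ = 1

variable {κ : Type*} [Fintype κ] {c : NNReal}

theorem IsIndepSubGaussian.precomp {ι ι' : Type*} {a : ι → S → ℝ} (h : IsIndepSubGaussian a c μ)
    {g : ι' → ι} (hg : g.Injective) : IsIndepSubGaussian (fun i => a (g i)) c μ :=
  ⟨fun _ => h.measurable _, h.indep.precomp hg, fun _ => h.subgaussian _, fun _ => h.centered _,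
    fun _ => h.variance_eq _⟩

theorem IsIndepSubGaussian.hasSubgaussianMGF_sum {a : κ → S → ℝ} (h : IsIndepSubGaussian a c μ)
    {y : κ → ℝ} (hy : ∑ j, y j ^ 2 ≤ 1) :
    HasSubgaussianMGF (fun ω => ∑ j, a j ω * y j) c μ := by
  have h1 := HasSubgaussianMGF.sum_of_iIndepFun (s := Finset.univ)
    (h.indep.comp (fun j x => y j * x) fun j => measurable_const_mul _)
    fun j _ => (h.subgaussian j).const_mul (y j)
  refine ⟨fun t => ?_, fun t => ?_⟩
  · refine (h1.integrable_exp_mul t).congr (Filter.Eventually.of_forall fun ω => ?_)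
    simp [mul_comm]
  · have h2 := h1.mgf_le t
    simp only [Function.comp_def] at h2
    simp_rw [mul_comm (a _ _)]
    refine h2.trans (Real.exp_le_exp.2 ?_)
    gcongr
    rw [← NNReal.coe_le_coe, NNReal.coe_sum]
    calc ∑ j, y j ^ 2 * (c : ℝ) = (∑ j, y j ^ 2) * c := by rw [Finset.sum_mul]
      _ ≤ c := mul_le_of_le_one_left c.2 hy

theorem IsIndepSubGaussian.integral_sum_sq {a : κ → S → ℝ} (h : IsIndepSubGaussian a c μ)
    (y : κ → ℝ) : ∫ ω, (∑ j, a j ω * y j) ^ 2 ∂μ = ∑ j, y j ^ 2 := by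
  have := h.indep.isProbabilityMeasure
  have hL : ∀ j, MemLp (fun ω => a j ω * y j) 2 μ := fun j => by
    simpa [mul_comm] using ((h.subgaussian j).memLp 2).const_mul (y j)
  have hL1 : ∀ j, Integrable (fun ω => a j ω * y j) μ := fun j => (hL j).integrable (by norm_num)
  have hv := IndepFun.variance_sum (s := Finset.univ) (X := fun j ω => a j ω * y j) (μ := μ)
    (fun j _ => hL j) fun i _ j _ hij => (h.indep.indepFun hij).comp
      (measurable_mul_const (y i)) (measurable_mul_const (y j))
  have h0 : ∫ ω, (∑ j, fun ω => a j ω * y j) ω ∂μ = 0 := by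
    simp only [Finset.sum_apply]
    rw [integral_finsetSum _ fun j _ => hL1 j]
    simp [integral_mul_const, h.centered]
  rw [variance_of_integral_eq_zero (by fun_prop (disch := exact fun j => (h.measurable j))) h0] at hv
  simp only [Finset.sum_apply] at hv
  rw [hv]
  refine Finset.sum_congr rfl fun j _ => ?_
  simp_rw [mul_comm (a j _)]
  rw [variance_const_mul, h.variance_eq, mul_one]

end Independence

/-! ### Lower tail of `‖G x‖²`, uniformly over a subspace. -/

section UniformLowerTail

variable {S : Type*} [MeasurableSpace S] {μ : Measure S} {κ : Type*} [Fintype κ] {c : NNReal}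

/-- The symmetric bilinear form `⟨x, y⟩ ↦ ⟨G x, G y⟩ - l ⟨x, y⟩` of a real matrix with `l` rows. -/
noncomputable def gramDefect {l : ℕ} (g : Fin l → κ → ℝ) (W : Submodule ℝ (EuclideanSpace ℝ κ)) :
    W →ₗ[ℝ] W →ₗ[ℝ] ℝ :=
  LinearMap.mk₂ ℝ
    (fun x y => ∑ i, (∑ j, g i j * (x : EuclideanSpace ℝ κ) j) *
      (∑ j, g i j * (y : EuclideanSpace ℝ κ) j) - l * inner ℝ x y)
    (fun x x' y => by
      simp only [Submodule.coe_add, PiLp.add_apply, mul_add, Finset.sum_add_distrib, add_mul,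
        inner_add_left]
      ring)
    (fun r x y => by
      have : ∀ i, ∑ j, g i j * (r * (x : EuclideanSpace ℝ κ) j)
          = r * ∑ j, g i j * (x : EuclideanSpace ℝ κ) j := fun i => by
        rw [Finset.mul_sum]; exact Finset.sum_congr rfl fun j _ => by ring
      simp only [Submodule.coe_smul, PiLp.smul_apply, smul_eq_mul, this, mul_assoc,
        ← Finset.mul_sum, real_inner_smul_left]
      ring)
    (fun x y y' => by
      simp only [Submodule.coe_add, PiLp.add_apply, mul_add, Finset.sum_add_distrib,
        inner_add_right]
      ring)
    (fun r x y => by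
      simp only [Submodule.coe_smul, PiLp.smul_apply, smul_eq_mul, mul_left_comm _ r,
        ← Finset.mul_sum, real_inner_smul_right]
      ring)

theorem gramDefect_self {l : ℕ} (g : Fin l → κ → ℝ) (W : Submodule ℝ (EuclideanSpace ℝ κ))
    (x : W) : gramDefect g W x x
      = ∑ i, (∑ j, g i j * (x : EuclideanSpace ℝ κ) j) ^ 2 - l * ‖x‖ ^ 2 := by
  simp [gramDefect, sq]

theorem gramDefect_comm {l : ℕ} (g : Fin l → κ → ℝ) (W : Submodule ℝ (EuclideanSpace ℝ κ))
    (x y : W) : gramDefect g W x y = gramDefect g W y x := by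
  simp only [gramDefect, LinearMap.mk₂_apply, real_inner_comm]
  simp only [mul_comm]

variable [IsProbabilityMeasure μ] {l : ℕ} {a : Fin l → κ → S → ℝ}

theorem measureReal_abs_sum_sq_sub_norm_sq_ge_le (hc : 0 < c) (hc1 : 1 / 4 ≤ (c : ℝ))
    (ha : IsIndepSubGaussian (fun p : Fin l × κ => a p.1 p.2) c μ) {ε : ℝ} (hε : 0 ≤ ε)
    (hε1 : ε ≤ 1) (y : EuclideanSpace ℝ κ) (hy : ‖y‖ = 1) :
    μ.real {ω | ε * l ≤ |∑ i, (∑ j, a i j ω * y j) ^ 2 - l|}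
      ≤ 2 * Real.exp (-(l * (1 / (4 * c)) ^ 2 * ε ^ 2 / 192)) := by
  have hy2 : ∑ j, y j ^ 2 = 1 := by
    rw [← EuclideanSpace.real_norm_sq_eq, hy, one_pow]
  have hm : ∀ i j, Measurable (a i j) := fun i j => ha.measurable (i, j)
  have hrow : ∀ i, IsIndepSubGaussian (a i) c μ := fun i =>
    ha.precomp (g := fun j => (i, j)) fun _ _ h => (Prod.mk.inj h).2
  have hc0 : (0 : ℝ) < c := hc
  refine measureReal_abs_sum_sq_sub_ge_le (Y := fun i ω => ∑ j, a i j ω * y j) (by positivity) ?_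
    hε hε1 (fun i => by fun_prop) ?_ (fun i => ?_) fun i => ?_
  · rw [div_le_one (by positivity)]
    linarith
  · exact (iIndepFun_rows hm ha.indep).comp (fun _ r => ∑ j, r j * y j) fun _ => by fun_prop
  · exact ((hrow i).hasSubgaussianMGF_sum hy2.le).expSqBound hc
  · rw [(hrow i).integral_sum_sq, hy2]

/-- Lower tail of the quadratic form of a random matrix with independent sub-Gaussian entries,
uniformly over a subspace of dimension at most `d`. -/
theorem measureReal_exists_sum_sq_lt_le (hc : 0 < c) (hc1 : 1 / 4 ≤ (c : ℝ))
    (ha : IsIndepSubGaussian (fun p : Fin l × κ => a p.1 p.2) c μ) {ε : ℝ} (hε : 0 ≤ ε)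
    (hε1 : ε ≤ 1) (W : Submodule ℝ (EuclideanSpace ℝ κ)) {d : ℕ} (hd : Module.finrank ℝ W ≤ d) :
    μ.real {ω | ∃ x ∈ W, ∑ i, (∑ j, a i j ω * x j) ^ 2 < l * (1 - ε) * ‖x‖ ^ 2}
      ≤ 25 ^ d * (2 * Real.exp (-(l * ε ^ 2 / (49152 * c ^ 2)))) := by
  obtain ⟨N, hcard, hN⟩ := exists_finset_card_le_forall_norm_le_one (E := W)
  set P : ℝ := 2 * Real.exp (-(l * ε ^ 2 / (49152 * (c : ℝ) ^ 2))) with hP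
  -- The threshold `ε / 4` compensates for the factor `4` lost in passing from the net to all of
  -- `W`. The strict inequality makes `T 0` empty, so the zero vector may belong to the net.
  set T : W → Set S := fun y => {ω | ε / 4 * l * ‖y‖ ^ 2
    < |∑ i, (∑ j, a i j ω * (y : EuclideanSpace ℝ κ) j) ^ 2 - l * ‖y‖ ^ 2|} with hT
  have hTP : ∀ y, μ.real (T y) ≤ P := by
    intro y
    rcases eq_or_ne y 0 with rfl | hy
    · have : T 0 = ∅ := by ext; simp [hT]
      rw [this]
      simp [hP, (Real.exp_pos _).le]
    have hny : 0 < ‖y‖ := norm_pos_iff.2 hy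
    have hny' : 0 < ‖y‖ ^ 2 := by positivity
    have h1 := measureReal_abs_sum_sq_sub_norm_sq_ge_le hc hc1 ha (ε := ε / 4) (by positivity)
      (by linarith) (‖y‖⁻¹ • (y : EuclideanSpace ℝ κ))
      (by rw [norm_smul, norm_inv, norm_norm]; exact inv_mul_cancel₀ hny.ne')
    refine (measureReal_mono fun ω hω => ?_).trans (h1.trans (le_of_eq ?_))
    · have h2 : ∀ i, ∑ j, a i j ω * (‖y‖⁻¹ • (y : EuclideanSpace ℝ κ)) j
          = ‖y‖⁻¹ * ∑ j, a i j ω * (y : EuclideanSpace ℝ κ) j := fun i => by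
        rw [Finset.mul_sum]
        refine Finset.sum_congr rfl fun j _ => ?_
        simp only [PiLp.smul_apply, smul_eq_mul]
        ring
      have hω' : ε / 4 * l * ‖y‖ ^ 2
          < |∑ i, (∑ j, a i j ω * (y : EuclideanSpace ℝ κ) j) ^ 2 - l * ‖y‖ ^ 2| := hω
      simp only [Set.mem_ofPred_eq, h2, mul_pow, ← Finset.mul_sum]
      have h3 : (‖y‖⁻¹ ^ 2 * ∑ i, (∑ j, a i j ω * (y : EuclideanSpace ℝ κ) j) ^ 2 - l)
          = (∑ i, (∑ j, a i j ω * (y : EuclideanSpace ℝ κ) j) ^ 2 - l * ‖y‖ ^ 2) / ‖y‖ ^ 2 := by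
        field_simp
      rw [h3, abs_div, abs_of_pos hny', le_div_iff₀ hny']
      exact hω'.le
    -- With `ν = 1 / (4 c)` and `ε / 4` in place of `ε`, the constant is `192 · 16 · 16 = 49152`.
    · rw [hP]
      congr 3
      have hc0 : (c : ℝ) ≠ 0 := by exact_mod_cast hc.ne'
      field_simp
      norm_num
      ring
  have hsub : {ω | ∃ x ∈ W, ∑ i, (∑ j, a i j ω * x j) ^ 2 < l * (1 - ε) * ‖x‖ ^ 2}
      ⊆ ⋃ y ∈ N, T y := by
    rintro ω ⟨x, hxW, hx⟩
    by_contra hcon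
    simp only [Set.mem_iUnion, not_exists, hT, Set.mem_ofPred_eq, not_lt] at hcon
    have h1 := abs_bilin_self_le_of_net (gramDefect_comm (fun i j => a i j ω) W) hN
      (δ := ε / 4 * l) (by positivity)
      (fun y hy => by rw [gramDefect_self]; exact hcon y hy) ⟨x, hxW⟩
    rw [gramDefect_self] at h1
    have h2 := (abs_le.1 h1).1
    simp only [Submodule.coe_norm] at h2
    linarith
  calc _ ≤ μ.real (⋃ y ∈ N, T y) := measureReal_mono hsub (measure_ne_top _ _)
    _ ≤ ∑ y ∈ N, μ.real (T y) := measureReal_biUnion_finset_le _ _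
    _ ≤ ∑ _y ∈ N, P := Finset.sum_le_sum fun y _ => hTP y
    _ = N.card * P := by rw [Finset.sum_const, nsmul_eq_mul]
    _ ≤ 25 ^ d * P := by
        have hP0 : 0 ≤ P := by positivity
        gcongr
        have : N.card ≤ 25 ^ d := hcard.trans (Nat.pow_le_pow_right (by norm_num) hd)
        exact_mod_cast this

end UniformLowerTail

/-! ### Upper tail of weighted sums of squares. -/

section WeightedSquares

variable {S : Type*} [MeasurableSpace S] {μ : Measure S}

/-- By convexity of `exp`, the exponential of the weighted mean of the `ν X²` is at most the
weighted mean of their exponentials, whose expectation is at most `2`; then Markov. No independence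
between the variables enters. -/
theorem measureReal_sum_weighted_sq_ge_le {ι : Type*} [Fintype ι] {X : ι → S → ℝ} {ν : ℝ}
    (hν : 0 < ν) (hX : ∀ q, ExpSqBound (X q) ν μ) {w : ι → ℝ} (hw : ∀ q, 0 ≤ w q)
    (hw0 : 0 < ∑ q, w q) (v : ℝ) :
    μ.real {ω | (∑ q, w q) * v ≤ ∑ q, w q * X q ω ^ 2} ≤ 2 * Real.exp (-(ν * v)) := by
  set T := ∑ q, w q with hT
  set F : S → ℝ := fun ω => ∑ q, w q / T * Real.exp (ν * X q ω ^ 2) with hF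
  have hFint : Integrable F μ := integrable_finsetSum _ fun q _ => (hX q).integrable.const_mul _
  have hwT : ∑ q, w q / T = 1 := by rw [← Finset.sum_div, div_self hw0.ne']
  have hF2 : ∫ ω, F ω ∂μ ≤ 2 := by
    rw [integral_finsetSum _ fun q _ => (hX q).integrable.const_mul _]
    calc _ = ∑ q, w q / T * ∫ ω, Real.exp (ν * X q ω ^ 2) ∂μ := by simp_rw [integral_const_mul]
      _ ≤ ∑ q, w q / T * 2 := Finset.sum_le_sum fun q _ =>
          mul_le_mul_of_nonneg_left (hX q).integral_le (div_nonneg (hw q) hw0.le)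
      _ = 2 := by rw [← Finset.sum_mul, hwT, one_mul]
  have hF0 : 0 ≤ F := fun ω => Finset.sum_nonneg fun q _ =>
    mul_nonneg (div_nonneg (hw q) hw0.le) (Real.exp_pos _).le
  have hsub : {ω | T * v ≤ ∑ q, w q * X q ω ^ 2} ⊆ {ω | Real.exp (ν * v) ≤ F ω} := by
    intro ω hω
    have hω' : T * v ≤ ∑ q, w q * X q ω ^ 2 := hω
    have hj := convexOn_exp.map_sum_le (t := Finset.univ) (w := fun q => w q / T)
      (p := fun q => ν * X q ω ^ 2) (fun q _ => div_nonneg (hw q) hw0.le) hwT fun _ _ => trivial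
    simp only [smul_eq_mul] at hj
    refine le_trans (Real.exp_le_exp.2 ?_) hj
    have : ∑ q, w q / T * (ν * X q ω ^ 2) = ν * ((∑ q, w q * X q ω ^ 2) / T) := by
      rw [Finset.sum_div, Finset.mul_sum]
      exact Finset.sum_congr rfl fun q _ => by ring
    rw [this]
    gcongr
    rw [le_div_iff₀ hw0]
    linarith
  have hmk := mul_meas_ge_le_integral_of_nonneg (Filter.Eventually.of_forall hF0) hFint
    (Real.exp (ν * v))
  have hfin : μ {ω | Real.exp (ν * v) ≤ F ω} ≠ ∞ := by
    have := hFint.measure_ge_lt_top (Real.exp_pos (ν * v))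
    exact this.ne
  calc _ ≤ μ.real {ω | Real.exp (ν * v) ≤ F ω} := measureReal_mono hsub hfin
    _ ≤ 2 * Real.exp (-(ν * v)) := by
        rw [Real.exp_neg, ← div_eq_mul_inv, le_div_iff₀ (Real.exp_pos _), mul_comm]
        exact hmk.trans hF2

end WeightedSquares

/-! ### Frobenius geometry of quaternion matrices. -/

section Frobenius

variable {m n p q : ℕ}

theorem norm_sq_eq_sum {α β : Type*} [Fintype α] [Fintype β] {R : Type*} [NormedAddCommGroup R]
    (M : Matrix α β R) : ‖M‖ ^ 2 = ∑ i, ∑ j, ‖M i j‖ ^ 2 := by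
  rw [Matrix.frobenius_norm_def, ← Real.sqrt_eq_rpow, Real.sq_sqrt (by positivity)]
  simp

/-- The real part of a quaternion as a linear map. -/
def reLin : ℍ[ℝ] →ₗ[ℝ] ℝ where
  toFun q := q.re
  map_add' _ _ := rfl
  map_smul' _ _ := rfl

theorem reLin_apply (q : ℍ[ℝ]) : reLin q = q.re := rfl

theorem norm_sq_eq_re_trace (M : Matrix (Fin m) (Fin n) ℍ[ℝ]) :
    ‖M‖ ^ 2 = reLin (Mᴴ * M).trace := by
  rw [norm_sq_eq_sum, Finset.sum_comm]
  simp only [Matrix.trace, Matrix.diag, Matrix.mul_apply, Matrix.conjTranspose_apply]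
  simp only [map_sum]
  refine Finset.sum_congr rfl fun j _ => Finset.sum_congr rfl fun i _ => ?_
  rw [Quaternion.star_mul_self, Quaternion.normSq_eq_norm_mul_self, reLin_apply, sq]
  rfl

theorem norm_add_sq_of_conjTranspose_mul_eq_zero {M N : Matrix (Fin m) (Fin n) ℍ[ℝ]}
    (h : Mᴴ * N = 0) : ‖M + N‖ ^ 2 = ‖M‖ ^ 2 + ‖N‖ ^ 2 := by
  have h' : Nᴴ * M = 0 := by
    rw [← Matrix.conjTranspose_conjTranspose M, ← Matrix.conjTranspose_mul, h,
      Matrix.conjTranspose_zero]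
  simp only [norm_sq_eq_re_trace, Matrix.conjTranspose_add, Matrix.add_mul, Matrix.mul_add,
    h, h', add_zero, zero_add, Matrix.trace_add, map_add]

theorem norm_le_norm_add_of_conjTranspose_mul_eq_zero {M N : Matrix (Fin m) (Fin n) ℍ[ℝ]}
    (h : Mᴴ * N = 0) : ‖M‖ ≤ ‖M + N‖ := by
  rw [← sq_le_sq₀ (norm_nonneg _) (norm_nonneg _), norm_add_sq_of_conjTranspose_mul_eq_zero h]
  linarith [sq_nonneg ‖N‖]

theorem norm_mul_of_conjTranspose_mul_self {U : Matrix (Fin p) (Fin m) ℍ[ℝ]} (hU : Uᴴ * U = 1)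
    (M : Matrix (Fin m) (Fin n) ℍ[ℝ]) : ‖U * M‖ = ‖M‖ := by
  rw [← sq_eq_sq₀ (norm_nonneg _) (norm_nonneg _), norm_sq_eq_re_trace, norm_sq_eq_re_trace,
    Matrix.conjTranspose_mul, Matrix.mul_assoc, ← Matrix.mul_assoc Uᴴ, hU, Matrix.one_mul]

theorem norm_mul_conjTranspose_of_conjTranspose_mul_self {V : Matrix (Fin p) (Fin n) ℍ[ℝ]}
    (hV : Vᴴ * V = 1) (M : Matrix (Fin m) (Fin n) ℍ[ℝ]) : ‖M * Vᴴ‖ = ‖M‖ := by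
  rw [← Matrix.frobenius_norm_conjTranspose, Matrix.conjTranspose_mul,
    Matrix.conjTranspose_conjTranspose, norm_mul_of_conjTranspose_mul_self hV,
    Matrix.frobenius_norm_conjTranspose]

theorem norm_projection_mul_le {Q : Matrix (Fin m) (Fin m) ℍ[ℝ]} (hQ : Qᴴ = Q) (hQ2 : Q * Q = Q)
    (M : Matrix (Fin m) (Fin n) ℍ[ℝ]) : ‖Q * M‖ ≤ ‖M‖ := by
  have h := norm_le_norm_add_of_conjTranspose_mul_eq_zero (M := Q * M) (N := M - Q * M) (by
    rw [Matrix.conjTranspose_mul, hQ, Matrix.mul_assoc, Matrix.mul_sub, ← Matrix.mul_assoc, hQ2,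
      sub_self, Matrix.mul_zero])
  rwa [add_sub_cancel] at h

theorem norm_sq_eq_sum_columns (M : Matrix (Fin m) (Fin n) ℍ[ℝ]) :
    ‖M‖ ^ 2 = ∑ j, ∑ i, ‖M i j‖ ^ 2 := by
  rw [norm_sq_eq_sum, Finset.sum_comm]

theorem norm_sq_mul_le_of_forall_mulVec {k : ℝ} {M : Matrix (Fin m) (Fin n) ℍ[ℝ]}
    {N : Matrix (Fin p) (Fin n) ℍ[ℝ]}
    (h : ∀ z, k * ∑ i, ‖(M *ᵥ z) i‖ ^ 2 ≤ ∑ i, ‖(N *ᵥ z) i‖ ^ 2)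
    (Z : Matrix (Fin n) (Fin q) ℍ[ℝ]) : k * ‖M * Z‖ ^ 2 ≤ ‖N * Z‖ ^ 2 := by
  rw [norm_sq_eq_sum_columns, norm_sq_eq_sum_columns, Finset.mul_sum]
  exact Finset.sum_le_sum fun j _ => h fun i => Z i j

theorem exists_mul_eq_mul_of_rightRange_subset {M : Matrix (Fin m) (Fin n) ℍ[ℝ]}
    {N : Matrix (Fin m) (Fin p) ℍ[ℝ]} (h : rightRange M ⊆ rightRange N)
    (Z : Matrix (Fin n) (Fin q) ℍ[ℝ]) : ∃ Z' : Matrix (Fin p) (Fin q) ℍ[ℝ], M * Z = N * Z' := by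
  have h1 : ∀ j, ∃ z, N *ᵥ z = M *ᵥ fun i => Z i j := fun j => h ⟨_, rfl⟩
  choose z hz using h1
  refine ⟨Matrix.of fun i j => z j i, ?_⟩
  ext1 i j
  exact (congrFun (hz j) i).symm

/-- The normal equations of a quaternion least squares problem are solvable. -/
theorem exists_conjTranspose_mul_sub_eq_zero (Y : Matrix (Fin m) (Fin p) ℍ[ℝ])
    (A : Matrix (Fin m) (Fin n) ℍ[ℝ]) :
    ∃ Z : Matrix (Fin p) (Fin n) ℍ[ℝ], Yᴴ * (A - Y * Z) = 0 := by
  let e : Matrix (Fin m) (Fin n) ℍ[ℝ] →ₗ[ℝ] PiLp 2 (fun _ : Fin m × Fin n => ℍ[ℝ]) :=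
    { toFun := fun M => WithLp.toLp 2 fun q => M q.1 q.2
      map_add' := fun _ _ => rfl
      map_smul' := fun _ _ => rfl }
  let L : Matrix (Fin p) (Fin n) ℍ[ℝ] →ₗ[ℝ] Matrix (Fin m) (Fin n) ℍ[ℝ] :=
    { toFun := fun Z => Y * Z
      map_add' := fun _ _ => Matrix.mul_add _ _ _
      map_smul' := fun _ _ => Matrix.mul_smul _ _ _ }
  have he : ∀ M N, inner ℝ (e M) (e N) = reLin (Mᴴ * N).trace := by
    intro M N
    rw [PiLp.inner_apply, Fintype.sum_prod_type, Finset.sum_comm]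
    simp only [Matrix.trace, Matrix.diag, Matrix.mul_apply, Matrix.conjTranspose_apply]
    simp only [map_sum]
    refine Finset.sum_congr rfl fun j _ => Finset.sum_congr rfl fun i _ => ?_
    change (M i j * star (N i j)).re = (star (M i j) * N i j).re
    simp
  let W := LinearMap.range (e ∘ₗ L)
  obtain ⟨Z, hZ⟩ := (W.orthogonalProjectionOnto (e A)).2
  refine ⟨Z, ?_⟩
  have hZ' : e (Y * Z) = W.orthogonalProjectionOnto (e A) := hZ
  set B := A - Y * Z with hB
  have horth : ∀ D : Matrix (Fin p) (Fin n) ℍ[ℝ], inner ℝ (e (Y * D)) (e B) = 0 := by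
    intro D
    rw [hB, map_sub, hZ']
    exact W.inner_right_of_mem_orthogonal (u := e (Y * D)) ⟨D, rfl⟩
      (W.sub_starProjection_mem_orthogonal (e A))
  -- Real orthogonality only says that the real part of `tr ((Y D)ᴴ B)` vanishes; with `D = Yᴴ B`
  -- this number is `‖Yᴴ B‖²`.
  have h1 := horth (Yᴴ * B)
  rw [he, Matrix.conjTranspose_mul, Matrix.mul_assoc, ← norm_sq_eq_re_trace] at h1
  exact norm_eq_zero.1 (pow_eq_zero_iff two_ne_zero |>.1 h1)

/-- The lower bound makes `M Mᴴ` injective, hence invertible with some inverse `N`, and `T = Mᴴ N`.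
Then `Mᴴ (C T)ᴴ` is the orthogonal projection `Mᴴ N M` applied to `Cᴴ`, so the lower bound applied
to `(C T)ᴴ` gives the norm estimate. -/
theorem exists_right_inverse_norm_mul_le {k : ℝ} (hk : 0 < k) {M : Matrix (Fin p) (Fin q) ℍ[ℝ]}
    (h : ∀ z : Fin p → ℍ[ℝ], k ^ 2 * ∑ i, ‖z i‖ ^ 2 ≤ ∑ i, ‖(Mᴴ *ᵥ z) i‖ ^ 2) :
    ∃ T : Matrix (Fin q) (Fin p) ℍ[ℝ], M * T = 1 ∧
      ∀ {m : ℕ} (C : Matrix (Fin m) (Fin q) ℍ[ℝ]), k * ‖C * T‖ ≤ ‖C‖ := by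
  let L : Matrix (Fin p) (Fin p) ℍ[ℝ] →ₗ[ℝ] Matrix (Fin p) (Fin p) ℍ[ℝ] :=
    { toFun := fun Z => M * Mᴴ * Z
      map_add' := fun _ _ => Matrix.mul_add _ _ _
      map_smul' := fun _ _ => Matrix.mul_smul _ _ _ }
  have hk2 : 0 < k ^ 2 := by positivity
  have hlow : ∀ {n : ℕ} (Z : Matrix (Fin p) (Fin n) ℍ[ℝ]), k ^ 2 * ‖Z‖ ^ 2 ≤ ‖Mᴴ * Z‖ ^ 2 := by
    intro n Z
    have := norm_sq_mul_le_of_forall_mulVec (k := k ^ 2) (M := (1 : Matrix (Fin p) (Fin p) ℍ[ℝ]))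
      (N := Mᴴ) (by simpa using h) Z
    rwa [Matrix.one_mul] at this
  have hinj : Function.Injective L := by
    rw [injective_iff_map_eq_zero]
    intro Z hZ
    have h1 : ‖Mᴴ * Z‖ ^ 2 = 0 := by
      rw [norm_sq_eq_re_trace, Matrix.conjTranspose_mul, Matrix.conjTranspose_conjTranspose,
        Matrix.mul_assoc, ← Matrix.mul_assoc M]
      change reLin (Zᴴ * L Z).trace = 0
      simp [hZ]
    have h2 := hlow Z
    rw [h1] at h2
    have h3 : ‖Z‖ ^ 2 ≤ 0 := by
      by_contra! hcon
      nlinarith [mul_pos hk2 hcon]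
    exact norm_eq_zero.1 (pow_eq_zero_iff two_ne_zero |>.1 (le_antisymm h3 (sq_nonneg _)))
  obtain ⟨N, hN⟩ := LinearMap.surjective_of_injective hinj 1
  have hN : M * Mᴴ * N = 1 := hN
  have hN' : Nᴴ * (M * Mᴴ) = 1 := by
    have := congrArg Matrix.conjTranspose hN
    simpa [Matrix.conjTranspose_mul, Matrix.mul_assoc] using this
  have hNh : Nᴴ = N := by
    calc Nᴴ = Nᴴ * (M * Mᴴ * N) := by rw [hN, Matrix.mul_one]
      _ = N := by rw [← Matrix.mul_assoc, hN', Matrix.one_mul]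
  refine ⟨Mᴴ * N, by rw [← Matrix.mul_assoc, hN], fun {m} C => ?_⟩
  have hQ : (Mᴴ * N * M)ᴴ = Mᴴ * N * M := by
    rw [Matrix.conjTranspose_mul, Matrix.conjTranspose_mul, hNh,
      Matrix.conjTranspose_conjTranspose, Matrix.mul_assoc]
  have hQ2 : Mᴴ * N * M * (Mᴴ * N * M) = Mᴴ * N * M := by
    calc _ = Mᴴ * N * (M * Mᴴ * N) * M := by simp only [Matrix.mul_assoc]
      _ = _ := by rw [hN, Matrix.mul_one]
  have h1 := norm_projection_mul_le hQ hQ2 Cᴴ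
  have h2 := hlow ((C * (Mᴴ * N))ᴴ)
  have h3 : Mᴴ * (C * (Mᴴ * N))ᴴ = Mᴴ * N * M * Cᴴ := by
    rw [Matrix.conjTranspose_mul, Matrix.conjTranspose_mul, hNh,
      Matrix.conjTranspose_conjTranspose]
    simp only [Matrix.mul_assoc]
  rw [h3, Matrix.frobenius_norm_conjTranspose, ← mul_pow] at h2
  rw [Matrix.frobenius_norm_conjTranspose] at h1
  exact ((sq_le_sq₀ (by positivity) (norm_nonneg _)).1 h2).trans h1

end Frobenius

/-! ### Deterministic error bounds for the one-pass algorithm and the rangefinder. -/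

section Deterministic

variable {m n r s l : ℕ}

/-- Deterministic error bound for the QB stage in terms of the rangefinder residual. -/
theorem norm_mul_sub_le_of_isQBOutput {A : Matrix (Fin m) (Fin n) ℍ[ℝ]}
    {Ω : Matrix (Fin n) (Fin s) ℍ[ℝ]} {Ψ : Matrix (Fin l) (Fin m) ℍ[ℝ]}
    {H : Matrix (Fin m) (Fin s) ℍ[ℝ]} {X Z : Matrix (Fin s) (Fin n) ℍ[ℝ]} {k b : ℝ} (hk : 0 < k)
    (hlow : ∀ z, k ^ 2 * ∑ i, ‖((A * Ω) *ᵥ z) i‖ ^ 2 ≤ ∑ i, ‖((Ψ * (A * Ω)) *ᵥ z) i‖ ^ 2)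
    (hup : ‖Ψ * (A - A * Ω * Z)‖ ≤ b * ‖A - A * Ω * Z‖)
    (hout : IsQBOutput A Ω Ψ H X) : ‖H * X - A‖ ≤ (1 + b / k) * ‖A - A * Ω * Z‖ := by
  obtain ⟨hR, P, hP, rfl⟩ := hout
  set Y := A * Ω
  set B := A - Y * Z with hB
  obtain ⟨Z₂, hZ₂⟩ := exists_mul_eq_mul_of_rightRange_subset hR.ge Z
  obtain ⟨Z₃, hZ₃⟩ := exists_mul_eq_mul_of_rightRange_subset hR.le (P * (Ψ * A) - Z₂)
  set Q := Ψ * H * P with hQ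
  have hQ2 : Q * Q = Q := by
    rw [hQ, ← Matrix.mul_assoc, hP.mul_mul_left]
  have hD : H * (P * (Ψ * A)) - Y * Z = Y * Z₃ := by rw [← hZ₃, Matrix.mul_sub, hZ₂]
  -- `Q` fixes the range of `Ψ H`, which contains that of `Ψ Y Z`; so `Q Ψ A - Ψ Y Z = Q Ψ (A - Y
  -- Z)`.
  have hΨD : Ψ * (Y * Z₃) = Q * (Ψ * B) := by
    have e1 : Ψ * (H * Z₂) = Q * (Ψ * (H * Z₂)) := by
      calc Ψ * (H * Z₂) = (Ψ * H * P * (Ψ * H)) * Z₂ := by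
            rw [hP.mul_mul_left, Matrix.mul_assoc]
        _ = _ := by simp only [hQ, Matrix.mul_assoc]
    rw [← hD, hB, hZ₂, Matrix.mul_sub, Matrix.mul_sub, Matrix.mul_sub, ← e1, hQ]
    simp only [Matrix.mul_assoc]
  have h1 : k * ‖Y * Z₃‖ ≤ b * ‖B‖ := by
    have h2 := norm_sq_mul_le_of_forall_mulVec hlow Z₃
    rw [← mul_pow, Matrix.mul_assoc Ψ, hΨD] at h2
    exact ((sq_le_sq₀ (by positivity) (norm_nonneg _)).1 h2).trans
      ((norm_projection_mul_le hP.left_hermitian hQ2 _).trans hup)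
  have h3 : H * (P * (Ψ * A)) - A = Y * Z₃ - B := by rw [← hD, hB]; abel
  rw [h3]
  calc ‖Y * Z₃ - B‖ ≤ ‖Y * Z₃‖ + ‖B‖ := norm_sub_le _ _
    _ ≤ b * ‖B‖ / k + ‖B‖ := by
        gcongr
        rw [le_div_iff₀ hk]
        linarith
    _ = _ := by ring

theorem norm_sub_le_of_conjTranspose_mul_eq_zero {A : Matrix (Fin m) (Fin n) ℍ[ℝ]}
    {Y : Matrix (Fin m) (Fin s) ℍ[ℝ]} {Z : Matrix (Fin s) (Fin n) ℍ[ℝ]}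
    (h : Yᴴ * (A - Y * Z) = 0) (Z' : Matrix (Fin s) (Fin n) ℍ[ℝ]) :
    ‖A - Y * Z‖ ≤ ‖A - Y * Z'‖ := by
  have h1 : A - Y * Z' = (A - Y * Z) + Y * (Z - Z') := by rw [Matrix.mul_sub]; abel
  rw [h1]
  refine norm_le_norm_add_of_conjTranspose_mul_eq_zero ?_
  have h2 := congrArg Matrix.conjTranspose h
  rw [Matrix.conjTranspose_mul, Matrix.conjTranspose_conjTranspose, Matrix.conjTranspose_zero] at h2
  rw [← Matrix.mul_assoc, h2, Matrix.zero_mul]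

/-- The first `r` columns of the identity matrix of size `n`. -/
noncomputable def leadingColumns (n r : ℕ) : Matrix (Fin n) (Fin r) ℍ[ℝ] :=
  Matrix.of fun i j => if (i : ℕ) = j then 1 else 0

theorem leadingColumns_conjTranspose_mul_self (h : r ≤ n) :
    (leadingColumns n r)ᴴ * leadingColumns n r = 1 := by
  ext1 i j
  rw [Matrix.mul_apply, Finset.sum_eq_single ⟨i, i.2.trans_le h⟩]
  · by_cases hij : i = j
    · subst hij
      simp [leadingColumns]
    · have : (i : ℕ) ≠ j := fun h' => hij (Fin.ext h')
      simp [leadingColumns, this, hij]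
  · intro k _ hk
    have : (k : ℕ) ≠ i := fun h' => hk (Fin.ext h')
    simp [leadingColumns, this]
  · simp

/-- The diagonal `σ` with its first `r` entries replaced by zero. -/
noncomputable def tailDiagonal (r : ℕ) (σ : Fin (min m n) → ℝ) : Fin (min m n) → ℝ :=
  fun i => if (i : ℕ) < r then 0 else σ i

theorem norm_map_rectDiagonal_tailDiagonal (r : ℕ) (σ : Fin (min m n) → ℝ) :
    ‖(rectDiagonal (tailDiagonal r σ)).map (fun x : ℝ => (x : ℍ[ℝ]))‖ = ‖sigmaTwo r σ‖ := by
  rw [Matrix.frobenius_norm_map_eq _ _ fun a => Quaternion.norm_coe a,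
    ← sq_eq_sq₀ (norm_nonneg _) (norm_nonneg _), norm_sq_eq_sum, norm_sq_eq_sum]
  have hz : ∀ (i : Fin m) (j : Fin n), (i : ℕ) < r ∨ (j : ℕ) < r →
      rectDiagonal (tailDiagonal r σ) i j = 0 := by
    intro i j hij
    by_cases h : (i : ℕ) = j
    · have : (i : ℕ) < r := by omega
      simp [rectDiagonal, tailDiagonal, this]
    · simp [rectDiagonal, h]
  have he : ∀ (i : Fin m) (j : Fin n), r ≤ (i : ℕ) →
      rectDiagonal (tailDiagonal r σ) i j = rectDiagonal σ i j := by
    intro i j hi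
    simp [rectDiagonal, tailDiagonal, not_lt.2 hi]
  have h1 : ∀ i : Fin m, r ≤ (i : ℕ) → ∑ j, ‖rectDiagonal (tailDiagonal r σ) i j‖ ^ 2
      = ∑ j : {j : Fin n // r ≤ (j : ℕ)}, ‖rectDiagonal σ i j‖ ^ 2 := by
    intro i hi
    rw [← Finset.sum_filter_of_ne (p := fun j : Fin n => r ≤ (j : ℕ)),
      Finset.sum_subtype _ (p := fun j : Fin n => r ≤ (j : ℕ)) (by simp)]
    · exact Finset.sum_congr rfl fun j _ => by rw [he i j hi]
    · intro j _ hj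
      by_contra hcon
      exact hj (by rw [hz i j (Or.inr (not_le.1 hcon))]; simp)
  rw [← Finset.sum_filter_of_ne (p := fun i : Fin m => r ≤ (i : ℕ)),
    Finset.sum_subtype _ (p := fun i : Fin m => r ≤ (i : ℕ)) (by simp)]
  · exact Finset.sum_congr rfl fun i _ => h1 i i.2
  · intro i _ hi
    by_contra hcon
    exact hi (Finset.sum_eq_zero fun j _ => by rw [hz i j (Or.inl (not_le.1 hcon))]; simp)

theorem leadingColumns_mul_conjTranspose_self :
    leadingColumns n r * (leadingColumns n r)ᴴ
      = Matrix.diagonal fun j : Fin n => if (j : ℕ) < r then 1 else 0 := by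
  ext1 i j
  rw [Matrix.mul_apply]
  by_cases hi : (i : ℕ) < r
  · rw [Finset.sum_eq_single ⟨i, hi⟩]
    · by_cases hij : i = j
      · subst hij
        simp [leadingColumns, hi]
      · have : (j : ℕ) ≠ i := fun h' => hij (Fin.ext h'.symm)
        simp [leadingColumns, hij, this]
    · intro k _ hk
      have : (i : ℕ) ≠ k := fun h' => hk (Fin.ext h'.symm)
      simp [leadingColumns, this]
    · simp
  · rw [Finset.sum_eq_zero]
    · by_cases hij : i = j
      · subst hij
        simp [hi]
      · simp [hij]
    · intro k _
      have : (i : ℕ) ≠ k := by omega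
      simp [leadingColumns, this]

/-- The difference of the two diagonals lives in the first `r` columns, which the projection
preserves. This is why the leading part of `A` factors through the leading right singular vectors.
-/
theorem rectDiagonal_sub_tailDiagonal_mul (σ : Fin (min m n) → ℝ) :
    ((rectDiagonal σ).map (fun x : ℝ => (x : ℍ[ℝ])) -
      (rectDiagonal (tailDiagonal r σ)).map (fun x : ℝ => (x : ℍ[ℝ]))) *
      (leadingColumns n r * (leadingColumns n r)ᴴ) =
    (rectDiagonal σ).map (fun x : ℝ => (x : ℍ[ℝ])) -
      (rectDiagonal (tailDiagonal r σ)).map (fun x : ℝ => (x : ℍ[ℝ])) := by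
  ext1 i j
  rw [leadingColumns_mul_conjTranspose_self, Matrix.mul_diagonal]
  split_ifs with hj
  · rw [mul_one]
  · by_cases hij : (i : ℕ) = j
    · have : ¬ (i : ℕ) < r := by omega
      simp [rectDiagonal, tailDiagonal, this]
    · simp [rectDiagonal, hij]

/-- Deterministic error bound for the rangefinder: if `V₁` and `A₂` are the leading right singular
vectors and the tail of `A`, the residual of the projection onto the range of `A Ω` is controlled
by the smallest singular value of `Ωᴴ V₁` and the norm of `Ωᴴ A₂ᴴ`. -/
theorem norm_sub_le_of_isQSVD {A : Matrix (Fin m) (Fin n) ℍ[ℝ]} {U : Matrix (Fin m) (Fin m) ℍ[ℝ]}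
    {σ : Fin (min m n) → ℝ} {V : Matrix (Fin n) (Fin n) ℍ[ℝ]} (hA : IsQSVD A U σ V) (hr : r ≤ n) :
    ∃ (V₁ : Matrix (Fin n) (Fin r) ℍ[ℝ]) (A₂ : Matrix (Fin m) (Fin n) ℍ[ℝ]),
      V₁ᴴ * V₁ = 1 ∧ ‖A₂‖ = ‖sigmaTwo r σ‖ ∧
      ∀ {s : ℕ} (Ω : Matrix (Fin n) (Fin s) ℍ[ℝ]) (Z : Matrix (Fin s) (Fin n) ℍ[ℝ]) (k b : ℝ),
        0 < k → (A * Ω)ᴴ * (A - A * Ω * Z) = 0 →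
        (∀ z, k ^ 2 * ∑ i, ‖(V₁ *ᵥ z) i‖ ^ 2 ≤ ∑ i, ‖((Ωᴴ * V₁) *ᵥ z) i‖ ^ 2) →
        ‖Ωᴴ * A₂ᴴ‖ ≤ b * ‖A₂ᴴ‖ → ‖A - A * Ω * Z‖ ≤ (1 + b / k) * ‖sigmaTwo r σ‖ := by
  set J := leadingColumns n r with hJ
  set D := (rectDiagonal σ).map (fun x : ℝ => (x : ℍ[ℝ])) with hD
  set D₂ := (rectDiagonal (tailDiagonal r σ)).map (fun x : ℝ => (x : ℍ[ℝ])) with hD₂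
  have hU : Uᴴ * U = 1 := Unitary.star_mul_self_of_mem hA.left_unitary
  have hV : Vᴴ * V = 1 := Unitary.star_mul_self_of_mem hA.right_unitary
  have hJJ : Jᴴ * J = 1 := leadingColumns_conjTranspose_mul_self hr
  have hV₁ : (V * J)ᴴ * (V * J) = 1 := by
    rw [Matrix.conjTranspose_mul, Matrix.mul_assoc, ← Matrix.mul_assoc Vᴴ, hV, Matrix.one_mul, hJJ]
  set A₂ := U * D₂ * Vᴴ with hA₂
  have hA₂n : ‖A₂‖ = ‖sigmaTwo r σ‖ := by
    rw [hA₂, norm_mul_conjTranspose_of_conjTranspose_mul_self hV,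
      norm_mul_of_conjTranspose_mul_self hU, hD₂, norm_map_rectDiagonal_tailDiagonal]
  refine ⟨V * J, A₂, hV₁, hA₂n, fun {s} Ω Z k b hk hZ hlow hup => ?_⟩
  have hlow' : ∀ z : Fin r → ℍ[ℝ], k ^ 2 * ∑ i, ‖z i‖ ^ 2
      ≤ ∑ i, ‖(((V * J)ᴴ * Ω)ᴴ *ᵥ z) i‖ ^ 2 := by
    intro z
    have h1 := hlow z
    have h2 : ∑ i, ‖((V * J) *ᵥ z) i‖ ^ 2 = ∑ i, ‖z i‖ ^ 2 := by
      have h3 := norm_mul_of_conjTranspose_mul_self hV₁ (Matrix.of fun i (_ : Fin 1) => z i)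
      rw [← sq_eq_sq₀ (norm_nonneg _) (norm_nonneg _), norm_sq_eq_sum, norm_sq_eq_sum] at h3
      simp only [Fin.sum_univ_one] at h3
      exact h3
    rwa [h2, ← Matrix.conjTranspose_conjTranspose (V * J), ← Matrix.conjTranspose_mul] at h1
  obtain ⟨T, hT, hTn⟩ := exists_right_inverse_norm_mul_le hk hlow'
  set A₁ := U * (D - D₂) * Vᴴ with hA₁
  have hA12 : A = A₁ + A₂ := by
    rw [hA.eq_mul, hA₁, hA₂, ← Matrix.add_mul, ← Matrix.mul_add, sub_add_cancel]
  have hA₁V : A₁ * (V * J) * (V * J)ᴴ = A₁ := by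
    calc A₁ * (V * J) * (V * J)ᴴ = U * ((D - D₂) * ((Vᴴ * V) * (J * Jᴴ))) * Vᴴ := by
          rw [hA₁, Matrix.conjTranspose_mul]
          simp only [Matrix.mul_assoc]
      _ = A₁ := by rw [hV, Matrix.one_mul, hJ, hD, hD₂, rectDiagonal_sub_tailDiagonal_mul]
  have hA₁Z : A₁ * Ω * (T * (V * J)ᴴ) = A₁ := by
    calc A₁ * Ω * (T * (V * J)ᴴ) = A₁ * (V * J) * (V * J)ᴴ * Ω * (T * (V * J)ᴴ) := by rw [hA₁V]
      _ = A₁ * (V * J) * ((V * J)ᴴ * Ω * T) * (V * J)ᴴ := by simp only [Matrix.mul_assoc]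
      _ = A₁ := by rw [hT, Matrix.mul_one, hA₁V]
  have hres : A - A * Ω * (T * (V * J)ᴴ) = A₂ - A₂ * Ω * T * (V * J)ᴴ := by
    have : A * Ω * (T * (V * J)ᴴ) = A₁ + A₂ * Ω * T * (V * J)ᴴ := by
      nth_rewrite 1 [hA12]
      rw [Matrix.add_mul, Matrix.add_mul, hA₁Z, Matrix.mul_assoc (A₂ * Ω)]
    rw [this, hA12]
    abel
  -- The competitor `T V₁ᴴ` satisfies `A₁ Ω T V₁ᴴ = A₁`, so only the tail `A₂` contributes to its
  -- residual.
  refine (norm_sub_le_of_conjTranspose_mul_eq_zero hZ (T * (V * J)ᴴ)).trans ?_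
  rw [hres]
  have h1 : ‖A₂ * Ω‖ ≤ b * ‖sigmaTwo r σ‖ := by
    rw [← Matrix.conjTranspose_mul, Matrix.frobenius_norm_conjTranspose,
      Matrix.frobenius_norm_conjTranspose, hA₂n] at hup
    exact hup
  calc ‖A₂ - A₂ * Ω * T * (V * J)ᴴ‖ ≤ ‖A₂‖ + ‖A₂ * Ω * T * (V * J)ᴴ‖ := norm_sub_le _ _
    _ = ‖sigmaTwo r σ‖ + ‖A₂ * Ω * T‖ := by
        rw [hA₂n, norm_mul_conjTranspose_of_conjTranspose_mul_self hV₁]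
    _ ≤ ‖sigmaTwo r σ‖ + b * ‖sigmaTwo r σ‖ / k := by
        gcongr
        rw [le_div_iff₀ hk]
        linarith [hTn (A₂ * Ω)]
    _ = _ := by ring

end Deterministic

/-! ### From quaternion sketches to independent real rows. -/

section RealRows

variable {m n l : ℕ}

/-- The real coordinate vector of `conj x`, which pairs with the entries of the compact real
representation of a row `y` to give the real part of `y x`. -/
noncomputable def conjCoord : (Fin m → ℍ[ℝ]) →ₗ[ℝ] EuclideanSpace ℝ (Fin 4 × Fin m) where
  toFun x := WithLp.toLp 2 fun p =>
    ![(x p.2).re, -(x p.2).imI, -(x p.2).imJ, -(x p.2).imK] p.1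
  map_add' x y := by
    ext ⟨e, j⟩
    fin_cases e <;> simp <;> ring
  map_smul' c x := by
    ext ⟨e, j⟩
    fin_cases e <;> simp

theorem norm_conjCoord_sq (x : Fin m → ℍ[ℝ]) : ‖conjCoord x‖ ^ 2 = ∑ j, ‖x j‖ ^ 2 := by
  rw [EuclideanSpace.real_norm_sq_eq, Fintype.sum_prod_type, Finset.sum_comm]
  refine Finset.sum_congr rfl fun j _ => ?_
  rw [sq ‖x j‖, ← Quaternion.normSq_eq_norm_mul_self, Quaternion.normSq_def']
  simp [conjCoord, Fin.sum_univ_four]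

theorem re_mulVec (Q : Matrix (Fin l) (Fin m) ℍ[ℝ]) (x : Fin m → ℍ[ℝ]) (i : Fin l) :
    ((Q *ᵥ x) i).re
      = ∑ p : Fin 4 × Fin m, compactReal Q (p.1, i) p.2 * conjCoord x p := by
  rw [Fintype.sum_prod_type, Finset.sum_comm, Matrix.mulVec, dotProduct, ← reLin_apply, map_sum]
  refine Finset.sum_congr rfl fun j _ => ?_
  simp [conjCoord, compactReal, Fin.sum_univ_four, reLin_apply]
  ring

/-- The conjugates of the quaternion units `1, i, j, k`. -/
def conjUnit : Fin 4 → ℍ[ℝ] := ![⟨1, 0, 0, 0⟩, ⟨0, -1, 0, 0⟩, ⟨0, 0, -1, 0⟩, ⟨0, 0, 0, -1⟩]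

/-- Multiplication by a conjugate unit moves one component of `q` into the real part. In this way
every component of an entry of `G B` is a linear form in the real entries of one row of `G`. -/
theorem sum_re_mul_conjUnit_sq (q : ℍ[ℝ]) : ∑ e, (q * conjUnit e).re ^ 2 = ‖q‖ ^ 2 := by
  rw [sq ‖q‖, ← Quaternion.normSq_eq_norm_mul_self, Quaternion.normSq_def']
  simp [conjUnit, Fin.sum_univ_four]

theorem norm_conjUnit (e : Fin 4) : ‖conjUnit e‖ = 1 := by
  rw [← sq_eq_sq₀ (norm_nonneg _) zero_le_one, sq, ← Quaternion.normSq_eq_norm_mul_self,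
    Quaternion.normSq_def']
  fin_cases e <;> simp [conjUnit]

theorem sq_re_le_norm_sq (q : ℍ[ℝ]) : q.re ^ 2 ≤ ‖q‖ ^ 2 := by
  rw [sq ‖q‖, ← Quaternion.normSq_eq_norm_mul_self, Quaternion.normSq_def']
  nlinarith [sq_nonneg q.imI, sq_nonneg q.imJ, sq_nonneg q.imK]

variable {S : Type*} [MeasurableSpace S] {μ : Measure S} {c : NNReal}
  {G : S → Matrix (Fin l) (Fin m) ℍ[ℝ]}

/-- The rows of the compact real representation, arranged as real random vectors. -/
theorem IsIndepSubGaussian.compactReal_rows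
    (hG : IsIndepSubGaussian
      (fun (q : (Fin 4 × Fin l) × Fin m) ω => compactReal (G ω) q.1 q.2) c μ) :
    IsIndepSubGaussian (fun (p : Fin l × (Fin 4 × Fin m)) ω =>
      compactReal (G ω) (p.2.1, p.1) p.2.2) c μ :=
  hG.precomp (g := fun p : Fin l × (Fin 4 × Fin m) => ((p.2.1, p.1), p.2.2)) fun p p' h => by
    simp only [Prod.mk.injEq] at h
    ext <;> simp [h]

theorem IsIndepSubGaussian.mul_sign {ι : Type*} {a : ι → S → ℝ} (h : IsIndepSubGaussian a c μ)
    {σ : ι → ℝ} (hσ : ∀ i, σ i ^ 2 = 1) : IsIndepSubGaussian (fun i ω => σ i * a i ω) c μ where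
  measurable i := (h.measurable i).const_mul _
  indep := h.indep.comp (fun i x => σ i * x) fun i => measurable_const_mul _
  subgaussian i := by
    have h1 := (h.subgaussian i).const_mul (σ i)
    have h2 : (.mk (σ i ^ 2) (sq_nonneg _) : NNReal) * c = c := by
      rw [← NNReal.coe_inj, NNReal.coe_mul, NNReal.coe_mk, hσ, one_mul]
    exact h2 ▸ h1
  centered i := by rw [integral_const_mul, h.centered, mul_zero]
  variance_eq i := by rw [variance_const_mul, h.variance_eq, hσ, mul_one]

/-- Conjugate transposition permutes the real entries and changes the sign of the imaginary ones,
which affects none of the hypotheses. The estimates for `G` thereby apply to `Ωᴴ`. -/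
theorem IsIndepSubGaussian.conjTranspose
    (hG : IsIndepSubGaussian
      (fun (q : (Fin 4 × Fin l) × Fin m) ω => compactReal (G ω) q.1 q.2) c μ) :
    IsIndepSubGaussian
      (fun (q : (Fin 4 × Fin m) × Fin l) ω => compactReal (G ω)ᴴ q.1 q.2) c μ := by
  have h1 := (hG.precomp (g := fun q : (Fin 4 × Fin m) × Fin l => ((q.1.1, q.2), q.1.2))
    fun p p' h => by
      simp only [Prod.mk.injEq] at h
      ext <;> simp [h]).mul_sign (σ := fun q => ![1, -1, -1, -1] q.1.1)
      (fun ⟨⟨e, _⟩, _⟩ => by fin_cases e <;> simp)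
  convert h1 using 3 with q ω
  obtain ⟨⟨e, i⟩, j⟩ := q
  fin_cases e <;> simp [compactReal]

variable [IsProbabilityMeasure μ]

/-- Discarding the imaginary parts only decreases the left side and keeps one real form per row,
which makes the forms independent. The vectors `Y z` fill a real space of dimension at most `4 n`,
whence the size of the net. -/
theorem measureReal_exists_mulVec_lt_le (hc : 0 < c) (hc1 : 1 / 4 ≤ (c : ℝ))
    (hG : IsIndepSubGaussian
      (fun (q : (Fin 4 × Fin l) × Fin m) ω => compactReal (G ω) q.1 q.2) c μ)
    {ε : ℝ} (hε : 0 ≤ ε) (hε1 : ε ≤ 1) (Y : Matrix (Fin m) (Fin n) ℍ[ℝ]) :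
    μ.real {ω | ∃ z, ∑ i, ‖((G ω * Y) *ᵥ z) i‖ ^ 2 < l * (1 - ε) * ∑ i, ‖(Y *ᵥ z) i‖ ^ 2}
      ≤ 25 ^ (4 * n) * (2 * Real.exp (-(l * ε ^ 2 / (49152 * c ^ 2)))) := by
  let L : (Fin n → ℍ[ℝ]) →ₗ[ℝ] EuclideanSpace ℝ (Fin 4 × Fin m) :=
    conjCoord ∘ₗ { toFun := fun z => Y *ᵥ z
                   map_add' := fun _ _ => Matrix.mulVec_add _ _ _
                   map_smul' := fun _ _ => Matrix.mulVec_smul _ _ _ }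
  have hd : Module.finrank ℝ (LinearMap.range L) ≤ 4 * n := by
    refine (LinearMap.finrank_range_le L).trans ?_
    rw [Module.finrank_pi_fintype]
    simp [Quaternion.finrank_eq_four, mul_comm]
  refine (measureReal_mono (fun ω hω => ?_) (measure_ne_top _ _)).trans
    (measureReal_exists_sum_sq_lt_le (a := fun i p ω => compactReal (G ω) (p.1, i) p.2) hc hc1
      hG.compactReal_rows hε hε1 (LinearMap.range L) hd)
  obtain ⟨z, hz⟩ := hω
  refine ⟨L z, ⟨z, rfl⟩, ?_⟩
  have h1 : ‖L z‖ ^ 2 = ∑ i, ‖(Y *ᵥ z) i‖ ^ 2 := norm_conjCoord_sq _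
  rw [h1]
  refine lt_of_le_of_lt ?_ hz
  refine Finset.sum_le_sum fun i _ => ?_
  have h2 : ∑ j, compactReal (G ω) (j.1, i) j.2 * L z j = ((G ω *ᵥ (Y *ᵥ z)) i).re :=
    (re_mulVec _ _ _).symm
  rw [h2, Matrix.mulVec_mulVec]
  exact sq_re_le_norm_sq _

theorem measureReal_norm_mul_gt_le (hc : 0 < c)
    (hG : IsIndepSubGaussian
      (fun (q : (Fin 4 × Fin l) × Fin m) ω => compactReal (G ω) q.1 q.2) c μ)
    (hl : 0 < l) (B : Matrix (Fin m) (Fin n) ℍ[ℝ]) (v : ℝ) :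
    μ.real {ω | 4 * l * v * ‖B‖ ^ 2 < ‖G ω * B‖ ^ 2} ≤ 2 * Real.exp (-(v / (4 * c))) := by
  rcases eq_or_ne B 0 with rfl | hB
  · simp [(Real.exp_pos _).le]
  set y : Fin 4 → Fin n → EuclideanSpace ℝ (Fin 4 × Fin m) :=
    fun e k => conjCoord fun j => B j k * conjUnit e with hy
  have hyn : ∀ e k, ‖y e k‖ ^ 2 = ∑ j, ‖B j k‖ ^ 2 := fun e k => by
    simp [hy, norm_conjCoord_sq, norm_conjUnit]
  -- Each `X q` is a normalized component of an entry of `G B`. A zero column is harmless: as `0⁻¹ =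
  -- 0`, both its variable and its weight vanish.
  set X : (Fin 4 × Fin l) × Fin n → S → ℝ := fun q ω =>
    ∑ p : Fin 4 × Fin m, compactReal (G ω) (p.1, q.1.2) p.2 *
      (‖y q.1.1 q.2‖⁻¹ • y q.1.1 q.2 : EuclideanSpace ℝ (Fin 4 × Fin m)) p with hX
  set w : (Fin 4 × Fin l) × Fin n → ℝ := fun q => ‖y q.1.1 q.2‖ ^ 2 with hw
  have hXb : ∀ q, ExpSqBound (X q) (1 / (4 * c)) μ := by
    intro q
    have hrow : IsIndepSubGaussian (fun (p : Fin 4 × Fin m) ω =>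
        compactReal (G ω) (p.1, q.1.2) p.2) c μ :=
      hG.precomp (g := fun p : Fin 4 × Fin m => ((p.1, q.1.2), p.2)) fun p p' h => by
        simp only [Prod.mk.injEq] at h
        ext <;> simp [h]
    refine (hrow.hasSubgaussianMGF_sum ?_).expSqBound hc
    rw [← EuclideanSpace.real_norm_sq_eq, norm_smul, norm_inv, norm_norm]
    exact pow_le_one₀ (by positivity) (inv_mul_le_one)
  have hwX : ∀ q ω, w q * X q ω ^ 2 = ((G ω * B) q.1.2 q.2 * conjUnit q.1.1).re ^ 2 := by
    rintro ⟨⟨e, i⟩, k⟩ ω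
    have h1 : ((G ω * B) i k * conjUnit e).re
        = ∑ p : Fin 4 × Fin m, compactReal (G ω) (p.1, i) p.2 * y e k p := by
      rw [hy, ← re_mulVec]
      congr 1
      rw [Matrix.mul_apply, Matrix.mulVec, dotProduct, Finset.sum_mul]
      exact Finset.sum_congr rfl fun j _ => mul_assoc _ _ _
    have h2 : X ((e, i), k) ω = ‖y e k‖⁻¹ *
        ∑ p : Fin 4 × Fin m, compactReal (G ω) (p.1, i) p.2 * y e k p := by
      rw [hX, Finset.mul_sum]
      refine Finset.sum_congr rfl fun p _ => ?_
      simp only [PiLp.smul_apply, smul_eq_mul]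
      ring
    simp only [h1, h2, hw]
    rcases eq_or_ne (y e k) 0 with h0 | h0
    · simp [h0]
    · have : ‖y e k‖ ≠ 0 := norm_ne_zero_iff.2 h0
      field_simp
  have hsw : ∑ q, w q = 4 * l * ‖B‖ ^ 2 := by
    rw [Fintype.sum_prod_type]
    simp only [hw, hyn]
    rw [norm_sq_eq_sum, Finset.sum_comm (γ := Fin m)]
    simp
  have hsX : ∀ ω, ∑ q, w q * X q ω ^ 2 = ‖G ω * B‖ ^ 2 := by
    intro ω
    rw [norm_sq_eq_sum]
    simp only [hwX, Fintype.sum_prod_type, ← sum_re_mul_conjUnit_sq]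
    rw [Finset.sum_comm]
    exact Finset.sum_congr rfl fun i _ => Finset.sum_comm
  have hB0 : 0 < ‖B‖ := norm_pos_iff.2 hB
  have hl' : (0 : ℝ) < l := by exact_mod_cast hl
  have hc0 : (0 : ℝ) < c := hc
  have hν : 0 < 1 / (4 * (c : ℝ)) := by positivity
  have := measureReal_sum_weighted_sq_ge_le (w := w) hν hXb (fun q => sq_nonneg _)
    (by rw [hsw]; positivity) v
  simp_rw [hsX, hsw] at this
  rw [one_div_mul_eq_div] at this
  refine (measureReal_mono (fun ω hω => ?_) (measure_ne_top _ _)).trans this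
  have hω' : 4 * l * v * ‖B‖ ^ 2 < ‖G ω * B‖ ^ 2 := hω
  change 4 * l * ‖B‖ ^ 2 * v ≤ ‖G ω * B‖ ^ 2
  linarith

theorem IsSubGaussianMatrix.isIndepSubGaussian {K : ℝ} (hG : IsSubGaussianMatrix μ G)
    (hl : 0 < l) (hm : 0 < m)
    (hK : ∀ p j, psi2Norm μ (fun ω => compactReal (G ω) p j) = ENNReal.ofReal K) :
    0 < K ∧ 1 / 2 ≤ K ^ 2 ∧
    IsIndepSubGaussian (fun (q : (Fin 4 × Fin l) × Fin m) ω => compactReal (G ω) q.1 q.2)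
      (108 * K ^ 2).toNNReal μ := by
  -- Unit variance and the second moment bound give `1 ≤ 2 K'²`. Allowing any `K' ≥ K` also excludes
  -- `K ≤ 0`, where `ENNReal.ofReal K = 0`, through `K' = 1 / 2`.
  have key : ∀ K' : ℝ, 0 < K' → K ≤ K' → 1 / 2 ≤ K' ^ 2 := by
    intro K' hK' hKK'
    set X : S → ℝ := fun ω => compactReal (G ω) (0, ⟨0, hl⟩) ⟨0, hm⟩ with hX
    have hXm : Measurable X := hG.measurable _ _
    have h1 := lintegral_pow_le_of_psi2Norm_le (X := X) hK'
      ((hK _ _).trans_le (ENNReal.ofReal_le_ofReal hKK')) one_ne_zero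
    have h2 : ∫ ω, X ω ^ 2 ∂μ = 1 := by
      rw [← variance_of_integral_eq_zero hXm.aemeasurable (hG.centered _ _)]
      exact hG.unit_variance _ _
    rw [integral_eq_lintegral_of_nonneg_ae (Filter.Eventually.of_forall fun ω => sq_nonneg _)
      (hXm.pow_const 2).aestronglyMeasurable] at h2
    have h3 := ENNReal.toReal_le_of_le_ofReal (by positivity) h1
    simp only [mul_one] at h3
    rw [h2] at h3
    norm_num at h3
    linarith
  have hK0 : 0 < K := by
    by_contra! hcon
    have := key (1 / 2) (by norm_num) (by linarith)
    norm_num at this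
  refine ⟨hK0, key K hK0 le_rfl, fun q => hG.measurable _ _, hG.indep, fun q => ?_,
    fun q => hG.centered _ _, fun q => hG.unit_variance _ _⟩
  refine (ExpSqBound.of_psi2Norm_le hK0 (hG.measurable _ _).aemeasurable
    (hK q.1 q.2).le).hasSubgaussianMGF (by positivity) (hG.centered _ _) ?_
  rw [Real.coe_toNNReal _ (by positivity)]
  apply le_of_eq
  field_simp
  norm_num

end RealRows

/-! ### Measurability of projections, and continuity of matrix expressions. -/

section Measurability

/-- Projection along a compact space is a closed map; exhausting `Y` by compact sets writes the
projection of `C` as a countable union of closed sets. -/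
theorem measurableSet_exists_of_isClosed {X Y : Type*} [TopologicalSpace X] [MeasurableSpace X]
    [OpensMeasurableSpace X] [TopologicalSpace Y] [SigmaCompactSpace Y] {C : Set (X × Y)}
    (hC : IsClosed C) : MeasurableSet {x | ∃ y, (x, y) ∈ C} := by
  have h : {x | ∃ y, (x, y) ∈ C} = ⋃ N, Prod.fst '' {p : X × compactCovering Y N |
      (p.1, (p.2 : Y)) ∈ C} := by
    ext x
    simp only [Set.mem_ofPred_eq, Set.mem_iUnion, Set.mem_image, Prod.exists, exists_and_right,
      exists_eq_right, Subtype.exists]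
    constructor
    · rintro ⟨y, hy⟩
      obtain ⟨N, hN⟩ := exists_mem_compactCovering y
      exact ⟨N, y, hN, hy⟩
    · rintro ⟨N, y, _, hy⟩
      exact ⟨y, hy⟩
  rw [h]
  refine MeasurableSet.iUnion fun N => ?_
  have : CompactSpace (compactCovering Y N) :=
    isCompact_iff_compactSpace.1 (isCompact_compactCovering Y N)
  exact (isClosedMap_fst_of_compactSpace _ (hC.preimage (by fun_prop))).measurableSet

variable {m n p : ℕ} {X : Type*} [TopologicalSpace X]

/-- Entrywise continuity of a matrix valued map. -/
def EntryContinuous (F : X → Matrix (Fin m) (Fin n) ℍ[ℝ]) : Prop :=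
  ∀ i j, Continuous fun x => F x i j

theorem EntryContinuous.const (M : Matrix (Fin m) (Fin n) ℍ[ℝ]) :
    EntryContinuous fun _ : X => M := fun _ _ => continuous_const

theorem EntryContinuous.mul {F : X → Matrix (Fin m) (Fin n) ℍ[ℝ]}
    {G : X → Matrix (Fin n) (Fin p) ℍ[ℝ]} (hF : EntryContinuous F) (hG : EntryContinuous G) :
    EntryContinuous fun x => F x * G x := fun i j => by
  simp only [Matrix.mul_apply]
  exact continuous_finsetSum _ fun k _ => (hF i k).mul (hG k j)

theorem EntryContinuous.sub {F G : X → Matrix (Fin m) (Fin n) ℍ[ℝ]}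
    (hF : EntryContinuous F) (hG : EntryContinuous G) :
    EntryContinuous fun x => F x - G x := fun i j => (hF i j).sub (hG i j)

theorem EntryContinuous.conjTranspose {F : X → Matrix (Fin m) (Fin n) ℍ[ℝ]}
    (hF : EntryContinuous F) : EntryContinuous fun x => (F x)ᴴ := fun i j =>
  Continuous.star (hF j i)

theorem EntryContinuous.norm_sq {F : X → Matrix (Fin m) (Fin n) ℍ[ℝ]} (hF : EntryContinuous F) :
    Continuous fun x => ‖F x‖ ^ 2 := by
  simp only [norm_sq_eq_sum]
  exact continuous_finsetSum _ fun i _ => continuous_finsetSum _ fun j _ => (hF i j).norm.pow 2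

theorem EntryContinuous.sum_norm_mulVec_sq {F : X → Matrix (Fin m) (Fin n) ℍ[ℝ]}
    (hF : EntryContinuous F) (z : Fin n → ℍ[ℝ]) :
    Continuous fun x => ∑ i, ‖(F x *ᵥ z) i‖ ^ 2 := by
  simp only [Matrix.mulVec, dotProduct]
  exact continuous_finsetSum _ fun i _ =>
    (continuous_finsetSum _ fun j _ => (hF i j).mul continuous_const).norm.pow 2

theorem EntryContinuous.isClosed_eq_zero {F : X → Matrix (Fin m) (Fin n) ℍ[ℝ]}
    (hF : EntryContinuous F) : IsClosed {x | F x = 0} := by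
  have : {x | F x = 0} = ⋂ i, ⋂ j, {x | F x i j = 0} := by
    ext x
    simp only [Set.mem_ofPred_eq, Set.mem_iInter]
    exact ⟨fun h i j => by rw [h]; rfl, fun h => Matrix.ext h⟩
  rw [this]
  exact isClosed_iInter fun i => isClosed_iInter fun j => isClosed_eq (hF i j) continuous_const

/-- The quaternion matrix with a given compact real representation. -/
def ofCompactReal (g : Fin 4 × Fin m → Fin n → ℝ) : Matrix (Fin m) (Fin n) ℍ[ℝ] :=
  Matrix.of fun i j => ⟨g (0, i) j, g (1, i) j, g (2, i) j, g (3, i) j⟩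

theorem ofCompactReal_compactReal (Q : Matrix (Fin m) (Fin n) ℍ[ℝ]) :
    ofCompactReal (compactReal Q) = Q := by
  ext1 i j
  ext <;> rfl

theorem entryContinuous_ofCompactReal : EntryContinuous (ofCompactReal (m := m) (n := n)) := by
  intro i j
  let L : (Fin 4 × Fin m → Fin n → ℝ) →ₗ[ℝ] ℍ[ℝ] :=
    { toFun := fun g => ofCompactReal g i j
      map_add' := fun _ _ => rfl
      map_smul' := fun _ _ => rfl }
  exact L.continuous_of_finiteDimensional

theorem EntryContinuous.comp {Y : Type*} [TopologicalSpace Y]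
    {F : X → Matrix (Fin m) (Fin n) ℍ[ℝ]} (hF : EntryContinuous F) {f : Y → X}
    (hf : Continuous f) : EntryContinuous fun y => F (f y) := fun i j => (hF i j).comp hf

end Measurability

/-! ### The set of good sketching matrices. -/

section GoodSet

variable {m n s l : ℕ}

/-- Sketching matrices (given by their compact real representations) for which the range of `A Ω`
is not distorted by `Ψ`, and the least squares residual is not amplified by `Ψ`. -/
def goodSet (A : Matrix (Fin m) (Fin n) ℍ[ℝ]) (s l : ℕ) (k b : ℝ) :
    Set ((Fin 4 × Fin n → Fin s → ℝ) × (Fin 4 × Fin l → Fin m → ℝ)) :=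
  {p | (∀ z, k ^ 2 * ∑ i, ‖((A * ofCompactReal p.1) *ᵥ z) i‖ ^ 2
        ≤ ∑ i, ‖((ofCompactReal p.2 * (A * ofCompactReal p.1)) *ᵥ z) i‖ ^ 2) ∧
      ∃ Z : Fin s → Fin n → ℍ[ℝ],
        (A * ofCompactReal p.1)ᴴ * (A - A * ofCompactReal p.1 * Matrix.of Z) = 0 ∧
        ‖ofCompactReal p.2 * (A - A * ofCompactReal p.1 * Matrix.of Z)‖ ^ 2
          ≤ b ^ 2 * ‖A - A * ofCompactReal p.1 * Matrix.of Z‖ ^ 2}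

/-- The first condition is an intersection of closed conditions over `z`. The second is the
projection along `Z` of a closed set, so no measurable choice of the least squares solution is
needed. -/
theorem measurableSet_goodSet (A : Matrix (Fin m) (Fin n) ℍ[ℝ]) (k b : ℝ) :
    MeasurableSet (goodSet A s l k b) := by
  refine MeasurableSet.inter ?_ ?_
  · refine IsClosed.measurableSet ?_
    have h1 : EntryContinuous fun p : (Fin 4 × Fin n → Fin s → ℝ) × (Fin 4 × Fin l → Fin m → ℝ) =>
        A * ofCompactReal p.1 :=
      (EntryContinuous.const A).mul (entryContinuous_ofCompactReal.comp continuous_fst)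
    have h2 := (entryContinuous_ofCompactReal.comp continuous_snd).mul h1
    have h3 := isClosed_iInter fun z => isClosed_le
      ((continuous_const (y := k ^ 2)).mul (h1.sum_norm_mulVec_sq z)) (h2.sum_norm_mulVec_sq z)
    rwa [← Set.ofPred_forall] at h3
  · have : ProperSpace ℍ[ℝ] := FiniteDimensional.proper ℝ _
    have hY : EntryContinuous fun q :
        ((Fin 4 × Fin n → Fin s → ℝ) × (Fin 4 × Fin l → Fin m → ℝ)) ×
        (Fin s → Fin n → ℍ[ℝ]) => A * ofCompactReal q.1.1 :=
      (EntryContinuous.const A).mul (entryContinuous_ofCompactReal.comp (by fun_prop))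
    have hZ : EntryContinuous fun q :
        ((Fin 4 × Fin n → Fin s → ℝ) × (Fin 4 × Fin l → Fin m → ℝ)) ×
        (Fin s → Fin n → ℍ[ℝ]) => Matrix.of q.2 := fun i j => by
      simp only [Matrix.of_apply]
      fun_prop
    have hB := (EntryContinuous.const A).sub (hY.mul hZ)
    have hΨ : EntryContinuous fun q :
        ((Fin 4 × Fin n → Fin s → ℝ) × (Fin 4 × Fin l → Fin m → ℝ)) ×
        (Fin s → Fin n → ℍ[ℝ]) => ofCompactReal q.1.2 :=
      entryContinuous_ofCompactReal.comp (by fun_prop)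
    exact measurableSet_exists_of_isClosed
      (C := {q :
        ((Fin 4 × Fin n → Fin s → ℝ) × (Fin 4 × Fin l → Fin m → ℝ)) ×
        (Fin s → Fin n → ℍ[ℝ]) |
        (A * ofCompactReal q.1.1)ᴴ * (A - A * ofCompactReal q.1.1 * Matrix.of q.2) = 0 ∧
        ‖ofCompactReal q.1.2 * (A - A * ofCompactReal q.1.1 * Matrix.of q.2)‖ ^ 2
          ≤ b ^ 2 * ‖A - A * ofCompactReal q.1.1 * Matrix.of q.2‖ ^ 2})
      ((hY.conjTranspose.mul hB).isClosed_eq_zero.inter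
        (isClosed_le (hΨ.mul hB).norm_sq (continuous_const.mul hB.norm_sq)))

end GoodSet

/-! ### Conditioning on one of two independent variables. -/

section Fubini

variable {S α β : Type*} [MeasurableSpace S] [MeasurableSpace α] [MeasurableSpace β]
  {μ : Measure S} [IsProbabilityMeasure μ]

theorem _root_.ProbabilityTheory.IndepFun.measureReal_prodMk_notMem_le {X : S → α} {Y : S → β}
    (h : IndepFun X Y μ) (hX : Measurable X) (hY : Measurable Y) {D : Set (α × β)}
    (hD : MeasurableSet D) {q : ℝ} (hq : ∀ a, μ.real {ω | (a, Y ω) ∉ D} ≤ q) :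
    μ.real {ω | (X ω, Y ω) ∉ D} ≤ q := by
  have hpX : IsProbabilityMeasure (μ.map X) := Measure.isProbabilityMeasure_map hX.aemeasurable
  have hpY : IsProbabilityMeasure (μ.map Y) := Measure.isProbabilityMeasure_map hY.aemeasurable
  have hq0 : 0 ≤ q := by
    obtain ⟨ω⟩ := μ.nonempty_of_neZero
    exact measureReal_nonneg.trans (hq (X ω))
  have h1 : μ {ω | (X ω, Y ω) ∉ D} = ((μ.map X).prod (μ.map Y)) Dᶜ := by
    rw [← (indepFun_iff_map_prod_eq_prod_map_map hX.aemeasurable hY.aemeasurable).1 h,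
      Measure.map_apply (hX.prodMk hY) hD.compl]
    rfl
  have h2 : μ {ω | (X ω, Y ω) ∉ D} ≤ ENNReal.ofReal q := by
    rw [h1, Measure.prod_apply hD.compl]
    calc _ ≤ ∫⁻ _, ENNReal.ofReal q ∂(μ.map X) := lintegral_mono fun a => by
          rw [Measure.map_apply hY (measurable_prodMk_left hD.compl)]
          have := hq a
          rw [← ofReal_measureReal (measure_ne_top _ _)]
          exact ENNReal.ofReal_le_ofReal this
      _ = ENNReal.ofReal q := by simp
  exact ENNReal.toReal_le_of_le_ofReal hq0 h2

end Fubini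

/-! ### Tail bounds with the constants of the theorem. -/

section Quantitative

variable {m n l : ℕ} {S : Type*} [MeasurableSpace S] {μ : Measure S} [IsProbabilityMeasure μ]
  {G : S → Matrix (Fin l) (Fin m) ℍ[ℝ]} {K : ℝ}

theorem measureReal_exists_mulVec_lt_le_two_mul_exp (hK : 1 / 2 ≤ K ^ 2)
    (hG : IsIndepSubGaussian (fun (q : (Fin 4 × Fin l) × Fin m) ω => compactReal (G ω) q.1 q.2)
      (108 * K ^ 2).toNNReal μ) {t : ℝ} (ht : 0 < t)
    (hpos : 0 < √(l : ℝ) - 100000 * (K ^ 2 + 1) * √(n : ℝ) - t)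
    (Y : Matrix (Fin m) (Fin n) ℍ[ℝ]) :
    μ.real {ω | ∃ z, ∑ i, ‖((G ω * Y) *ᵥ z) i‖ ^ 2
        < (√(l : ℝ) - 100000 * (K ^ 2 + 1) * √(n : ℝ) - t) ^ 2 * ∑ i, ‖(Y *ᵥ z) i‖ ^ 2}
      ≤ 2 * Real.exp (-(t ^ 2 / (573308928 * K ^ 4))) := by
  set C : ℝ := 100000 * (K ^ 2 + 1) with hC
  have hC0 : 0 ≤ C := by positivity
  have hsn : 0 ≤ C * √(n : ℝ) := by positivity
  have hl : 0 < √(l : ℝ) := by linarith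
  have hl2 : √(l : ℝ) ^ 2 = l := Real.sq_sqrt l.cast_nonneg
  have hn2 : √(n : ℝ) ^ 2 = n := Real.sq_sqrt n.cast_nonneg
  have hK2 : 0 < K ^ 2 := by linarith
  have hK4 : 0 < K ^ 4 := by
    have : K ^ 4 = (K ^ 2) ^ 2 := by ring
    rw [this]; positivity
  -- Chosen so that `√l (1 - ε)` is the required lower bound. Since `(1 - ε)² ≤ 1 - ε`, the uniform
  -- lower tail applies.
  set ε : ℝ := (C * √(n : ℝ) + t) / √(l : ℝ) with hε
  have hε0 : 0 ≤ ε := by positivity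
  have hε1 : ε ≤ 1 := by rw [hε, div_le_one hl]; linarith
  have hk : √(l : ℝ) - C * √(n : ℝ) - t = √(l : ℝ) * (1 - ε) := by
    rw [hε]; field_simp; ring
  have hc : ((108 * K ^ 2).toNNReal : ℝ) = 108 * K ^ 2 := Real.coe_toNNReal _ (by positivity)
  have h1 := measureReal_exists_mulVec_lt_le (n := n) (by rw [Real.toNNReal_pos]; positivity)
    (by rw [hc]; linarith) hG hε0 hε1 Y
  refine (measureReal_mono (fun ω hω => ?_) (measure_ne_top _ _)).trans (h1.trans ?_)
  · obtain ⟨z, hz⟩ := hω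
    refine ⟨z, hz.trans_le ?_⟩
    rw [hk, mul_pow, hl2]
    gcongr
    nlinarith
  · rw [hc]
    have h25 : (25 : ℝ) ^ (4 * n) ≤ Real.exp (16 * n) := by
      have : (25 : ℝ) ≤ Real.exp 4 := by
        have h2 : Real.exp 4 = Real.exp 1 ^ 4 := by rw [← Real.exp_nat_mul]; norm_num
        rw [h2]
        calc (25 : ℝ) ≤ 2.7 ^ 4 := by norm_num
          _ ≤ _ := by gcongr; linarith [Real.exp_one_gt_d9]
      calc (25 : ℝ) ^ (4 * n) ≤ Real.exp 4 ^ (4 * n) := by gcongr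
        _ = _ := by
            rw [← Real.exp_nat_mul]
            push_cast
            ring_nf
    -- Here `l ε² = (C √n + t)² ≥ C² n + t²`, and the part `C² n` pays for the net because `16 ·
    -- 573308928 ≤ 10 ^ 10`.
    have hexp : 16 * (n : ℝ) + -(l * ε ^ 2 / (49152 * (108 * K ^ 2) ^ 2))
        ≤ -(t ^ 2 / (573308928 * K ^ 4)) := by
      have e1 : (l : ℝ) * ε ^ 2 = (C * √(n : ℝ) + t) ^ 2 := by
        rw [hε, div_pow, hl2]
        have : (l : ℝ) ≠ 0 := by rw [← hl2]; positivity
        field_simp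
      have e2 : (49152 : ℝ) * (108 * K ^ 2) ^ 2 = 573308928 * K ^ 4 := by ring
      have e3 : C ^ 2 * n + t ^ 2 ≤ (C * √(n : ℝ) + t) ^ 2 := by
        have : (C * √(n : ℝ) + t) ^ 2 = C ^ 2 * √(n : ℝ) ^ 2 + t ^ 2 + 2 * (C * √(n : ℝ)) * t := by
          ring
        rw [this, hn2]
        have : 0 ≤ 2 * (C * √(n : ℝ)) * t := by positivity
        linarith
      have e4 : 10000000000 * K ^ 4 ≤ C ^ 2 := by
        rw [hC]
        nlinarith
      have e5 : 16 * (n : ℝ) * (573308928 * K ^ 4) ≤ C ^ 2 * n := by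
        have : (n : ℝ) * (10000000000 * K ^ 4) ≤ n * C ^ 2 := by gcongr
        have : 0 ≤ (n : ℝ) * K ^ 4 := by positivity
        linarith
      rw [e1, e2, ← sub_nonneg]
      have hK0 : K ≠ 0 := (pow_ne_zero_iff two_ne_zero).1 hK2.ne'
      have : -(t ^ 2 / (573308928 * K ^ 4)) - (16 * (n : ℝ) +
          -((C * √(n : ℝ) + t) ^ 2 / (573308928 * K ^ 4)))
          = ((C * √(n : ℝ) + t) ^ 2 - t ^ 2 - 16 * (n : ℝ) * (573308928 * K ^ 4)) /
            (573308928 * K ^ 4) := by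
        field_simp
        ring
      rw [this]
      exact div_nonneg (by linarith) (by positivity)
    calc (25 : ℝ) ^ (4 * n) * (2 * Real.exp (-(l * ε ^ 2 / (49152 * (108 * K ^ 2) ^ 2))))
        ≤ Real.exp (16 * n) * (2 * Real.exp (-(l * ε ^ 2 / (49152 * (108 * K ^ 2) ^ 2)))) := by
          gcongr
      _ = 2 * Real.exp (16 * n + -(l * ε ^ 2 / (49152 * (108 * K ^ 2) ^ 2))) := by
          rw [Real.exp_add]; ring
      _ ≤ _ := by gcongr

/-- The tail bound is `2 exp (-L)` with `L = log N + log (4 l) + 1`; the first logarithm gives `1 /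
N`, the other two terms outweigh the factor `2`. -/
theorem measureReal_norm_mul_gt_le_one_div (hK : 1 / 2 ≤ K ^ 2)
    (hG : IsIndepSubGaussian (fun (q : (Fin 4 × Fin l) × Fin m) ω => compactReal (G ω) q.1 q.2)
      (108 * K ^ 2).toNNReal μ) (hl : 0 < l) {N : ℝ} (hN : 1 ≤ N)
    (B : Matrix (Fin m) (Fin n) ℍ[ℝ]) :
    μ.real {ω | (K * √(l : ℝ) * √(2 * (Real.log N + Real.log (4 * (l : ℝ)) + 1) / (1 / 864))) ^ 2
      * ‖B‖ ^ 2 < ‖G ω * B‖ ^ 2} ≤ 1 / N := by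
  have hl1 : (1 : ℝ) ≤ l := by exact_mod_cast hl
  set L := Real.log N + Real.log (4 * (l : ℝ)) + 1 with hL
  have hlogN := Real.log_nonneg hN
  have hlogl : 0 ≤ Real.log (4 * (l : ℝ)) := Real.log_nonneg (by linarith)
  have hL0 : 0 ≤ L := by positivity
  have hc : ((108 * K ^ 2).toNNReal : ℝ) = 108 * K ^ 2 := Real.coe_toNNReal _ (by positivity)
  have hK2 : 0 < K ^ 2 := by linarith
  have h1 := measureReal_norm_mul_gt_le (by rw [Real.toNNReal_pos]; positivity) hG hl B
    (432 * K ^ 2 * L)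
  have h2 : (K * √(l : ℝ) * √(2 * L / (1 / 864))) ^ 2 = 4 * l * (432 * K ^ 2 * L) := by
    rw [mul_pow, mul_pow, Real.sq_sqrt l.cast_nonneg, Real.sq_sqrt (by positivity)]
    ring
  rw [h2]
  refine h1.trans ?_
  have h3 : 432 * K ^ 2 * L / (4 * (108 * K ^ 2)) = L := by
    have : K ≠ 0 := (pow_ne_zero_iff two_ne_zero).1 hK2.ne'
    field_simp
    ring
  rw [hc, h3, hL]
  have hN0 : 0 < N := by linarith
  have h4 : 2 ≤ Real.exp (Real.log (4 * (l : ℝ)) + 1) := by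
    calc (2 : ℝ) ≤ Real.exp 1 := by linarith [Real.exp_one_gt_d9]
      _ ≤ _ := Real.exp_le_exp.2 (by linarith)
  rw [add_assoc, neg_add, Real.exp_add, Real.exp_neg, Real.exp_log hN0, Real.exp_neg]
  rw [one_div, mul_left_comm]
  refine mul_le_of_le_one_right (by positivity) ?_
  rw [← div_eq_mul_inv]
  exact (div_le_one (Real.exp_pos _)).2 h4

end Quantitative

/-! ### Combining the estimates for the two sketches. -/

section Sketch

variable {m n s l r : ℕ} {S : Type*} [MeasurableSpace S] {μ : Measure S}
  {Ω : S → Matrix (Fin n) (Fin s) ℍ[ℝ]} {Ψ : S → Matrix (Fin l) (Fin m) ℍ[ℝ]} {K : ℝ}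

theorem measurable_compactReal {G : S → Matrix (Fin m) (Fin n) ℍ[ℝ]}
    (hG : IsSubGaussianMatrix μ G) : Measurable fun ω p j => compactReal (G ω) p j :=
  measurable_pi_lambda _ fun p => measurable_pi_lambda _ fun j => hG.measurable p j

/-- Once the value of `Ω` is frozen, `Y = A Ω` and a least squares solution `Z` are deterministic,
so the bounds for fixed matrices apply to `Y` and `A - Y Z`; independence then averages over `Ω`. -/
theorem measureReal_notMem_goodSet_le [IsProbabilityMeasure μ] (hΩ : IsSubGaussianMatrix μ Ω)
    (hΨ : IsSubGaussianMatrix μ Ψ)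
    (hind : IndepFun (fun ω p j => compactReal (Ω ω) p j) (fun ω p j => compactReal (Ψ ω) p j) μ)
    (A : Matrix (Fin m) (Fin n) ℍ[ℝ]) {k b p q : ℝ}
    (hlow : ∀ Y : Matrix (Fin m) (Fin s) ℍ[ℝ], μ.real {ω | ∃ z, ∑ i, ‖((Ψ ω * Y) *ᵥ z) i‖ ^ 2
        < k ^ 2 * ∑ i, ‖(Y *ᵥ z) i‖ ^ 2} ≤ p)
    (hup : ∀ B : Matrix (Fin m) (Fin n) ℍ[ℝ],
      μ.real {ω | b ^ 2 * ‖B‖ ^ 2 < ‖Ψ ω * B‖ ^ 2} ≤ q) :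
    μ.real {ω | ((fun p j => compactReal (Ω ω) p j), (fun p j => compactReal (Ψ ω) p j))
      ∉ goodSet A s l k b} ≤ p + q := by
  refine hind.measureReal_prodMk_notMem_le (measurable_compactReal hΩ) (measurable_compactReal hΨ)
    (measurableSet_goodSet A k b) fun g => ?_
  set Y := A * ofCompactReal g with hY
  obtain ⟨Z, hZ⟩ := exists_conjTranspose_mul_sub_eq_zero Y A
  refine (measureReal_mono (fun ω hω => ?_) (measure_ne_top _ _)).trans
    ((measureReal_union_le _ _).trans (add_le_add (hlow Y) (hup (A - Y * Z))))
  by_contra hcon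
  simp only [Set.mem_union, Set.mem_ofPred_eq, not_or, not_exists, not_lt] at hcon
  have hΨω : ofCompactReal (fun p j => compactReal (Ψ ω) p j) = Ψ ω :=
    ofCompactReal_compactReal (Ψ ω)
  refine hω ⟨fun z => ?_, Z, hZ, ?_⟩
  · change _ ≤ ∑ i, ‖((ofCompactReal (fun p j => compactReal (Ψ ω) p j) * Y) *ᵥ z) i‖ ^ 2
    rw [hΨω]
    exact hcon.1 z
  · change ‖ofCompactReal (fun p j => compactReal (Ψ ω) p j) * (A - Y * Z)‖ ^ 2 ≤ _
    rw [hΨω]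
    exact hcon.2

theorem measurableSet_forall_mulVec_le (hΩ : IsSubGaussianMatrix μ Ω)
    (V : Matrix (Fin n) (Fin r) ℍ[ℝ]) (k : ℝ) :
    MeasurableSet {ω | ∀ z, k * ∑ i, ‖(V *ᵥ z) i‖ ^ 2 ≤ ∑ i, ‖(((Ω ω)ᴴ * V) *ᵥ z) i‖ ^ 2} := by
  have h1 := entryContinuous_ofCompactReal.conjTranspose.mul
    (EntryContinuous.const (X := Fin 4 × Fin n → Fin s → ℝ) V)
  have h2 := isClosed_iInter fun z => isClosed_le
    (continuous_const (y := k * ∑ i, ‖(V *ᵥ z) i‖ ^ 2)) (h1.sum_norm_mulVec_sq z)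
  have h3 := measurable_compactReal hΩ h2.measurableSet
  rw [← Set.ofPred_forall] at h3
  have h4 : ∀ ω, ofCompactReal (fun p j => compactReal (Ω ω) p j) = Ω ω := fun ω =>
    ofCompactReal_compactReal (Ω ω)
  simpa only [Set.preimage_ofPred_eq, h4] using h3

theorem measurableSet_norm_mul_le (hΩ : IsSubGaussianMatrix μ Ω)
    (B : Matrix (Fin n) (Fin m) ℍ[ℝ]) (k : ℝ) :
    MeasurableSet {ω | ‖(Ω ω)ᴴ * B‖ ^ 2 ≤ k} := by
  have h1 := entryContinuous_ofCompactReal.conjTranspose.mul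
    (EntryContinuous.const (X := Fin 4 × Fin n → Fin s → ℝ) B)
  have h3 := measurable_compactReal hΩ
    (isClosed_le h1.norm_sq (continuous_const (y := k))).measurableSet
  have h4 : ∀ ω, ofCompactReal (fun p j => compactReal (Ω ω) p j) = Ω ω := fun ω =>
    ofCompactReal_compactReal (Ω ω)
  simpa only [Set.preimage_ofPred_eq, h4] using h3

/-- The two lower tail events together cost `4 u²` with `u = exp (-x)`. This is at most `2 u` when
`u ≤ 1 / 2`; otherwise the claimed lower bound for the probability is not positive. -/
theorem one_sub_le_of_four_mul_exp {p x y : ℝ} (hp0 : 0 ≤ p) (hy : 0 ≤ y)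
    (h : 1 - 4 * Real.exp (-(2 * x)) - y ≤ p) : 1 - 2 * Real.exp (-x) - y ≤ p := by
  have h1 : Real.exp (-(2 * x)) = Real.exp (-x) ^ 2 := by
    rw [← Real.exp_nat_mul]
    push_cast
    ring_nf
  rw [h1] at h
  rcases le_total (Real.exp (-x)) (1 / 2) with h2 | h2
  · nlinarith [Real.exp_pos (-x)]
  · linarith

end Sketch

end QuaternionSketch

theorem mainTheorem5 :
    ∃ (c₁ c₂ : ℝ) (C : ℝ → ℝ), 0 < c₁ ∧ 0 < c₂ ∧ (∀ K : ℝ, 0 < C K) ∧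
      ∀ (m n r s l : ℕ), r < s → s < l → l < min m n →
      ∀ (A : Matrix (Fin m) (Fin n) ℍ[ℝ])
        (U : Matrix (Fin m) (Fin m) ℍ[ℝ]) (σ : Fin (min m n) → ℝ)
        (V : Matrix (Fin n) (Fin n) ℍ[ℝ]), QuaternionSketch.IsQSVD A U σ V →
      ∀ (S : Type*) [MeasurableSpace S] (μ : Measure S) [IsProbabilityMeasure μ]
        (Ω : S → Matrix (Fin n) (Fin s) ℍ[ℝ]) (Ψ : S → Matrix (Fin l) (Fin m) ℍ[ℝ]) (K : ℝ),
        QuaternionSketch.IsSubGaussianMatrix μ Ω →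
        QuaternionSketch.IsSubGaussianMatrix μ Ψ →
        IndepFun (fun ω p j => QuaternionSketch.compactReal (Ω ω) p j)
          (fun ω p j => QuaternionSketch.compactReal (Ψ ω) p j) μ →
        (∀ p j, QuaternionSketch.psi2Norm μ (fun ω => QuaternionSketch.compactReal (Ω ω) p j)
          = ENNReal.ofReal K) →
        (∀ p j, QuaternionSketch.psi2Norm μ (fun ω => QuaternionSketch.compactReal (Ψ ω) p j)
          = ENNReal.ofReal K) →
      ∀ t : ℝ, 0 < t → 0 < √(l : ℝ) - C K * √(s : ℝ) - t → 0 < √(s : ℝ) - C K * √(r : ℝ) - t →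
      ∃ E : Set S, MeasurableSet E ∧
        1 - 2 * Real.exp (-(2 * c₂ * t ^ 2 / K ^ 4)) - 1 / min ((m : ℝ) - s) (n : ℝ)
            - 1 / (min (m : ℝ) (n : ℝ) - r) ≤ μ.real E ∧
        ∀ ω ∈ E, ∀ (H : Matrix (Fin m) (Fin s) ℍ[ℝ]) (X : Matrix (Fin s) (Fin n) ℍ[ℝ]),
          QuaternionSketch.IsQBOutput A (Ω ω) (Ψ ω) H X →
          ‖H * X - A‖ ≤
            (1 + K * √(l : ℝ) *
                √(2 * (Real.log (min ((m : ℝ) - s) (n : ℝ)) + Real.log (4 * (l : ℝ)) + 1) / c₁)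
                / (√(l : ℝ) - C K * √(s : ℝ) - t)) *
            (1 + K * √(s : ℝ) *
                √(2 * (Real.log (min (m : ℝ) (n : ℝ) - r) + Real.log (4 * (s : ℝ)) + 1) / c₁)
                / (√(s : ℝ) - C K * √(r : ℝ) - t)) *
            ‖QuaternionSketch.sigmaTwo r σ‖ := by
  -- The moment generating functions have parameter `108 K²`, that is `9 · 12 K²`; then `864 = 2 · 4
  -- · 108` and `2293235712 = 4 · 49152 · 108²`, where one factor `2` comes from
  -- `one_sub_le_of_four_mul_exp` and the other from the `2 c₂` in the statement.
  refine ⟨1 / 864, 1 / 2293235712, fun K => 100000 * (K ^ 2 + 1), by norm_num, by norm_num,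
    fun K => by positivity, ?_⟩
  intro m n r s l hrs hsl hlmn A U σ V hA S _ μ _ Ω Ψ K hΩ hΨ hind hΩK hΨK t ht hk hk₁
  have hlm : l < m := hlmn.trans_le (min_le_left _ _)
  have hln : l < n := hlmn.trans_le (min_le_right _ _)
  obtain ⟨hK0, hK, hΩi⟩ := hΩ.isIndepSubGaussian (by omega) (by omega) hΩK
  obtain ⟨-, -, hΨi⟩ := hΨ.isIndepSubGaussian (by omega) (by omega) hΨK
  have hΩi' := hΩi.conjTranspose
  obtain ⟨V₁, A₂, hV₁, hA₂, hdet⟩ :=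
    QuaternionSketch.norm_sub_le_of_isQSVD (r := r) hA (by omega)
  have hN : 1 ≤ min ((m : ℝ) - s) (n : ℝ) := by
    have h1 : (s : ℝ) + 1 ≤ m := by exact_mod_cast (by omega : s + 1 ≤ m)
    have h2 : (1 : ℝ) ≤ n := by exact_mod_cast (by omega : 1 ≤ n)
    exact le_min (by linarith) h2
  have hN₁ : 1 ≤ min (m : ℝ) (n : ℝ) - r := by
    have h1 : (r : ℝ) + 1 ≤ m := by exact_mod_cast (by omega : r + 1 ≤ m)
    have h2 : (r : ℝ) + 1 ≤ n := by exact_mod_cast (by omega : r + 1 ≤ n)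
    linarith [le_min h1 h2]
  set N := min ((m : ℝ) - s) (n : ℝ)
  set N₁ := min (m : ℝ) (n : ℝ) - r
  beta_reduce at hk hk₁ ⊢
  set k := √(l : ℝ) - 100000 * (K ^ 2 + 1) * √(s : ℝ) - t
  set k₁ := √(s : ℝ) - 100000 * (K ^ 2 + 1) * √(r : ℝ) - t
  set b := K * √(l : ℝ) * √(2 * (Real.log N + Real.log (4 * (l : ℝ)) + 1) / (1 / 864))
  set b₁ := K * √(s : ℝ) * √(2 * (Real.log N₁ + Real.log (4 * (s : ℝ)) + 1) / (1 / 864))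
  have hb : 0 ≤ b := by positivity
  have hb₁ : 0 ≤ b₁ := by positivity
  set P := 2 * Real.exp (-(t ^ 2 / (573308928 * K ^ 4)))
  set D : Set S := {ω | ((fun p j => QuaternionSketch.compactReal (Ω ω) p j),
    (fun p j => QuaternionSketch.compactReal (Ψ ω) p j)) ∈ QuaternionSketch.goodSet A s l k b}
  set D₁ : Set S := {ω | ∀ z, k₁ ^ 2 * ∑ i, ‖(V₁ *ᵥ z) i‖ ^ 2
    ≤ ∑ i, ‖(((Ω ω)ᴴ * V₁) *ᵥ z) i‖ ^ 2}
  set D₂ : Set S := {ω | ‖(Ω ω)ᴴ * A₂ᴴ‖ ^ 2 ≤ b₁ ^ 2 * ‖A₂ᴴ‖ ^ 2}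
  have hD : MeasurableSet D := ((QuaternionSketch.measurable_compactReal hΩ).prodMk
    (QuaternionSketch.measurable_compactReal hΨ)) (QuaternionSketch.measurableSet_goodSet A k b)
  have hD₁ : MeasurableSet D₁ := QuaternionSketch.measurableSet_forall_mulVec_le hΩ V₁ _
  have hD₂ : MeasurableSet D₂ := QuaternionSketch.measurableSet_norm_mul_le hΩ A₂ᴴ _
  have hE : MeasurableSet (D ∩ (D₁ ∩ D₂)) := hD.inter (hD₁.inter hD₂)
  refine ⟨D ∩ (D₁ ∩ D₂), hE, ?_, ?_⟩
  · have hPD : μ.real Dᶜ ≤ P + 1 / N :=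
      QuaternionSketch.measureReal_notMem_goodSet_le hΩ hΨ hind A
        (QuaternionSketch.measureReal_exists_mulVec_lt_le_two_mul_exp hK hΨi ht hk)
        (QuaternionSketch.measureReal_norm_mul_gt_le_one_div hK hΨi (by omega) hN)
    have hPD₁ : μ.real D₁ᶜ ≤ P := by
      refine (measureReal_mono (fun ω hω => ?_) (measure_ne_top _ _)).trans
        (QuaternionSketch.measureReal_exists_mulVec_lt_le_two_mul_exp hK hΩi' ht hk₁ V₁)
      simpa [D₁] using hω
    have hPD₂ : μ.real D₂ᶜ ≤ 1 / N₁ := by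
      refine (measureReal_mono (fun ω hω => ?_) (measure_ne_top _ _)).trans
        (QuaternionSketch.measureReal_norm_mul_gt_le_one_div hK hΩi' (by omega) hN₁ A₂ᴴ)
      simpa only [D₂, Set.mem_compl_iff, Set.mem_ofPred_eq, not_le] using hω
    have hc : μ.real (D ∩ (D₁ ∩ D₂))ᶜ ≤ 2 * P + (1 / N + 1 / N₁) := by
      rw [Set.compl_inter, Set.compl_inter]
      linarith [measureReal_union_le (μ := μ) Dᶜ (D₁ᶜ ∪ D₂ᶜ),
        measureReal_union_le (μ := μ) D₁ᶜ D₂ᶜ]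
    rw [probReal_compl_eq_one_sub hE] at hc
    rw [sub_sub]
    refine QuaternionSketch.one_sub_le_of_four_mul_exp measureReal_nonneg (by positivity) ?_
    have hexp : 2 * (2 * (1 / 2293235712) * t ^ 2 / K ^ 4) = t ^ 2 / (573308928 * K ^ 4) := by
      field_simp
      norm_num
    rw [hexp]
    linarith
  · rintro ω ⟨⟨hlow, Z, hZ, hup⟩, hlow₁, hup₁⟩ H X hout
    have eΩ : QuaternionSketch.ofCompactReal
        (fun p j => QuaternionSketch.compactReal (Ω ω) p j) = Ω ω :=
      QuaternionSketch.ofCompactReal_compactReal (Ω ω)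
    have eΨ : QuaternionSketch.ofCompactReal
        (fun p j => QuaternionSketch.compactReal (Ψ ω) p j) = Ψ ω :=
      QuaternionSketch.ofCompactReal_compactReal (Ψ ω)
    simp only [eΩ, eΨ] at hlow hZ hup
    rw [← mul_pow, sq_le_sq₀ (norm_nonneg _) (by positivity)] at hup
    have hup₁' : ‖(Ω ω)ᴴ * A₂ᴴ‖ ≤ b₁ * ‖A₂ᴴ‖ := by
      have h : ‖(Ω ω)ᴴ * A₂ᴴ‖ ^ 2 ≤ b₁ ^ 2 * ‖A₂ᴴ‖ ^ 2 := hup₁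
      rwa [← mul_pow, sq_le_sq₀ (norm_nonneg _) (by positivity)] at h
    refine (QuaternionSketch.norm_mul_sub_le_of_isQBOutput hk hlow hup hout).trans ?_
    rw [mul_assoc]
    gcongr
    exact hdet (Ω ω) (Matrix.of Z) k₁ b₁ hk₁ hZ hlow₁ hup₁'
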